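/- **Setting.** Let $\mathbb D\subset\mathbb R^2$ be a domain (a non-empty connected open set) with coordinates $(x,y)$, and let $S$ be a smooth surface in $\mathbb P^3$ given over $\mathbb D$, in asymptotic coordinates, by a smooth lift $f:\mathbb D\to\mathbb R^4\setminus\{0\}$ (a column vector) solving the canonical system $$f_{xx}=b f_y+p f,\qquad f_{yy}=c f_x+q f$$ with smooth real functions $b,c,p,q$ and $bc\neq 0$ everywhere on $\mathbb D$. Let $F=(f,f_1,f_2,\eta)$ be its Wilczynski frame, $$f_1=f_x-\tfrac{c_x}{2c}f,\quad f_2=f_y-\tfrac{b_y}{2b}f,\quad \eta=f_{xy}-\tfrac{c_x}{2c}f_y-\tfrac{b_y}{2b}f_x+\Bigl(\tfrac{b_yc_x}{4bc}-\tfrac{bc}{2}\Bigr)f,$$ and assume that $F$ takes values in $\mathrm{SL}_4\mathbb R$. Put $$P=p+\tfrac{b_y}{2}-\tfrac{c_{xx}}{2c}+\tfrac{c_x^2}{4c^2},\qquad Q=q+\tfrac{c_x}{2}-\tfrac{b_{yy}}{2b}+\tfrac{b_y^2}{4b^2}.$$ * $S$ is a *Demoulin surface* if $P=Q=0$ on $\mathbb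 D$. * $S$ is *projective minimal* if $bQ_y+2b_yQ=0$ and $cP_x+2c_xP=0$ on $\mathbb D$ (the Euler–Lagrange equations of the projective area $\int bc\,dx\,dy$). * $S$ is a *coincidence surface* if near every point of $\mathbb D$ there are new asymptotic coordinates $(\tilde x,\tilde y)=(X(x),Y(y))$ and a new lift $\tilde f=\rho f$ ($\rho$ a nowhere vanishing function) whose canonical system has $b=c=1$: $\tilde f_{\tilde x\tilde x}=\tilde f_{\tilde y}+\tilde p\tilde f$, $\tilde f_{\tilde y\tilde y}=\tilde f_{\tilde x}+\tilde q\tilde f$ for some smooth functions $\tilde p,\tilde q$. Let $J_1$ be the $4\times4$ matrix with ones on the anti-diagonal and zeros elsewhere. Let $\mathcal Q\cong \mathrm{SL}_4\mathbb R/\mathrm{SO}_{2,2}$ be the space of symmetric real $4\times 4$ matrices of determinant one and signature $(2,2)$ with the $\mathrm{SL}_4\mathbb R$-invariant pseudo-Riemannian metric $\langle X,Y\rangle_g=\operatorname{Tr}(g^{-1}Xg^{-1}Y)$, and let $g_1=FJ_1F^t:\mathbb D\to\mathcal Q$ be the first-order Gauss map. It is *Lorentz harmonic* if its tension field vanishes,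 where $\mathbb D$ carries the Lorentz conformal structure with null coordinates $(x,y)$; equivalently $\nabla_{\partial_x}(g_1)_y+\nabla_{\partial_y}(g_1)_x=0$ for the Levi-Civita connection of $\mathcal Q$. Let $\mathfrak{sl}_4\mathbb R=\mathfrak k_1\oplus\mathfrak p_1$ be the decomposition into the $(+1)$- and $(-1)$-eigenspaces of the involution $\tau_1(X)=-J_1X^tJ_1$. With $F^{-1}dF=U\,dx+V\,dy$, set for $\lambda\in\mathbb R^\times$ $$\alpha^\lambda=(U_{\mathfrak k_1}+\lambda^{-1}U_{\mathfrak p_1})\,dx+(V_{\mathfrak k_1}+\lambda V_{\mathfrak p_1})\,dy .$$ **Theorem.** The following are equivalent: 1. $S$ is a Demoulin surface, or $S$ is a projective minimal coincidence surface. 2. The first-order Gauss map $g_1$ is a Lorentz harmonic map into $\mathcal Q$. 3. $d+\alpha^\lambda$ is flat for every $\lambda\in\mathbb R^\times$, that is, $d\alpha^\lambda+\tfrac12[\alpha^\lambda\wedge\alpha^\lambda]=0$ on $\mathbb D$. -/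

import Mathlib

open scoped ContDiff

noncomputable section

namespace ProjSurf

/-! ### Calculus in the `(x, y)`-plane -/

/-- Partial derivative with respect to the first variable. -/
def pdx {E : Type*} [NormedAddCommGroup E] [NormedSpace ℝ E] (h : ℝ × ℝ → E) (z : ℝ × ℝ) : E :=
  fderiv ℝ h z (1, 0)

/-- Partial derivative with respect to the second variable. -/
def pdy {E : Type*} [NormedAddCommGroup E] [NormedSpace ℝ E] (h : ℝ × ℝ → E) (z : ℝ × ℝ) : E :=
  fderiv ℝ h z (0, 1)

/-- Real `4 × 4` matrices. -/
abbrev Mat4 : Type := Matrix (Fin 4) (Fin 4) ℝ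

/-- Entrywise partial derivative in `x` of a matrix-valued function. -/
def mdx (A : ℝ × ℝ → Mat4) (z : ℝ × ℝ) : Mat4 :=
  Matrix.of fun i j => pdx (fun w => A w i j) z

/-- Entrywise partial derivative in `y` of a matrix-valued function. -/
def mdy (A : ℝ × ℝ → Mat4) (z : ℝ × ℝ) : Mat4 :=
  Matrix.of fun i j => pdy (fun w => A w i j) z

/-! ### Surfaces in real projective 3-space -/

/-- `f` is a smooth lift to `ℝ⁴`, over `D`, of a surface in projective 3-space, in asymptotic
coordinates `(x, y)`, normalized so that it solves the canonical system
`f_xx = b f_y + p f`, `f_yy = c f_x + q f` with smooth coefficients. -/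
structure IsCanonicalSystem (D : Set (ℝ × ℝ)) (b c p q : ℝ × ℝ → ℝ)
    (f : ℝ × ℝ → Fin 4 → ℝ) : Prop where
  smooth_b : ContDiffOn ℝ ∞ b D
  smooth_c : ContDiffOn ℝ ∞ c D
  smooth_p : ContDiffOn ℝ ∞ p D
  smooth_q : ContDiffOn ℝ ∞ q D
  smooth_f : ContDiffOn ℝ ∞ f D
  eq_xx : ∀ z ∈ D, pdx (pdx f) z = b z • pdy f z + p z • f z
  eq_yy : ∀ z ∈ D, pdy (pdy f) z = c z • pdx f z + q z • f z

/-- The Wilczynski frame `F = (f, f₁, f₂, η)`; the four vectors are the columns. -/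
def wilczynskiFrame (b c : ℝ × ℝ → ℝ) (f : ℝ × ℝ → Fin 4 → ℝ) (z : ℝ × ℝ) : Mat4 :=
  (Matrix.of ![
    f z,
    pdx f z - (pdx c z / (2 * c z)) • f z,
    pdy f z - (pdy b z / (2 * b z)) • f z,
    pdx (pdy f) z - (pdx c z / (2 * c z)) • pdy f z - (pdy b z / (2 * b z)) • pdx f z
      + (pdy b z * pdx c z / (4 * b z * c z) - b z * c z / 2) • f z]).transpose

/-- The function `P = p + b_y / 2 - c_xx / (2c) + c_x² / (4c²)`. -/
def invP (b c p : ℝ × ℝ → ℝ) (z : ℝ × ℝ) : ℝ :=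
  p z + pdy b z / 2 - pdx (pdx c) z / (2 * c z) + (pdx c z) ^ 2 / (4 * (c z) ^ 2)

/-- The function `Q = q + c_x / 2 - b_yy / (2b) + b_y² / (4b²)`. -/
def invQ (b c q : ℝ × ℝ → ℝ) (z : ℝ × ℝ) : ℝ :=
  q z + pdx c z / 2 - pdy (pdy b) z / (2 * b z) + (pdy b z) ^ 2 / (4 * (b z) ^ 2)

/-- Demoulin surfaces: `P = Q = 0`. -/
def IsDemoulin (D : Set (ℝ × ℝ)) (b c p q : ℝ × ℝ → ℝ) : Prop :=
  ∀ z ∈ D, invP b c p z = 0 ∧ invQ b c q z = 0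

/-- Projective minimal surfaces: the Euler-Lagrange equations
`b Q_y + 2 b_y Q = 0`, `c P_x + 2 c_x P = 0` of the projective area `∫ b c dx dy`. -/
def IsProjectiveMinimal (D : Set (ℝ × ℝ)) (b c p q : ℝ × ℝ → ℝ) : Prop :=
  ∀ z ∈ D,
    b z * pdy (invQ b c q) z + 2 * pdy b z * invQ b c q z = 0 ∧
    c z * pdx (invP b c p) z + 2 * pdx c z * invP b c p z = 0

/-- Coincidence surfaces: near every point one can pass to new asymptotic coordinates
`(X(x), Y(y))` and to a new lift `f'`, `f'(X(x), Y(y)) = ρ(x, y) f(x, y)`, for which the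
canonical system has `b = c = 1`, that is,
`f'_xx = f'_y + p' f'` and `f'_yy = f'_x + q' f'`. -/
def IsCoincidence (D : Set (ℝ × ℝ)) (f : ℝ × ℝ → Fin 4 → ℝ) : Prop :=
  ∀ z ∈ D, ∃ (I J : Set ℝ) (X Y : ℝ → ℝ) (ρ p' q' : ℝ × ℝ → ℝ) (f' : ℝ × ℝ → Fin 4 → ℝ),
    IsOpen I ∧ IsOpen J ∧ z.1 ∈ I ∧ z.2 ∈ J ∧ I ×ˢ J ⊆ D ∧
    ContDiffOn ℝ ∞ X I ∧ Set.InjOn X I ∧ (∀ x ∈ I, deriv X x ≠ 0) ∧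
    ContDiffOn ℝ ∞ Y J ∧ Set.InjOn Y J ∧ (∀ y ∈ J, deriv Y y ≠ 0) ∧
    ContDiffOn ℝ ∞ ρ (I ×ˢ J) ∧ (∀ w ∈ I ×ˢ J, ρ w ≠ 0) ∧
    (∀ w ∈ I ×ˢ J, f' (X w.1, Y w.2) = ρ w • f w) ∧
    IsCanonicalSystem ((X '' I) ×ˢ (Y '' J)) (fun _ => 1) (fun _ => 1) p' q' f'

/-! ### The space of quadrics of signature `(2, 2)` -/

/-- `J₁ = offdiag(1, 1, 1, 1)`. -/
def J₁ : Mat4 := !![0, 0, 0, 1; 0, 0, 1, 0; 0, 1, 0, 0; 1, 0, 0, 0]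

/-- The space of symmetric matrices of determinant one and signature `(2, 2)`, the orbit
`SL₄ℝ / SO₂,₂` of `J₁` under `g • P = g P gᵗ`. The signature is expressed by
congruence to `diag(1, 1, -1, -1)`. -/
def quadrics : Set Mat4 :=
  {P | P.IsSymm ∧ P.det = 1 ∧
    ∃ A : Mat4, IsUnit A.det ∧ P = A * Matrix.diagonal ![1, 1, -1, -1] * A.transpose}

/-- The invariant metric `⟨X, Y⟩_P = Tr(P⁻¹ X P⁻¹ Y)` on the space of quadrics. -/
def quadricMetric (P X Y : Mat4) : ℝ := (P⁻¹ * X * P⁻¹ * Y).trace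

/-- The Levi-Civita derivative, for `quadricMetric`, of a vector field `W` along a map `g` into the
space of quadrics: here `P` is the value of `g`, `G` its derivative in the given direction, and
`W`, `W'` are the value and the coordinate derivative of the field. -/
def covariantDeriv (P G W W' : Mat4) : Mat4 :=
  W' - (1 / 2 : ℝ) • (G * P⁻¹ * W + W * P⁻¹ * G)

/-- The connection is torsion free: its Christoffel term is symmetric. -/
theorem covariantDeriv_symm (P G W W' : Mat4) :
    covariantDeriv P G W W' = covariantDeriv P W G W' := by
  unfold covariantDeriv
  rw [add_comm]

section MetricCompatibility

open scoped Matrix.Norms.Operator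

/-- The connection is compatible with the metric. -/
theorem hasDerivAt_quadricMetric {g V W : ℝ → Mat4} {g' V' W' : Mat4} {t : ℝ}
    (hdet : IsUnit (g t).det)
    (hg : HasDerivAt g g' t) (hV : HasDerivAt V V' t) (hW : HasDerivAt W W' t) :
    HasDerivAt (fun s => quadricMetric (g s) (V s) (W s))
      (quadricMetric (g t) (covariantDeriv (g t) g' (V t) V') (W t) +
        quadricMetric (g t) (V t) (covariantDeriv (g t) g' (W t) W')) t := by
  have hu : IsUnit (g t) := (Matrix.isUnit_iff_isUnit_det _).2 hdet
  obtain ⟨u, hu⟩ := hu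
  have hi : HasDerivAt (fun s => (g s)⁻¹) (-((g t)⁻¹ * g' * (g t)⁻¹)) t := by
    have h1 := hasFDerivAt_ringInverse (𝕜 := ℝ) u
    rw [hu] at h1
    have h2 := h1.comp_hasDerivAt t hg
    have h3 : (g t)⁻¹ = ((u⁻¹ : Mat4ˣ) : Mat4) := by rw [← hu, Matrix.coe_units_inv]
    rw [h3]
    refine (h2.congr_deriv (by simp)).congr_of_eventuallyEq (.of_forall fun s => ?_)
    simp only [Function.comp_apply, Matrix.nonsing_inv_eq_ringInverse]
  have hm := (((hi.mul hV).mul hi).mul hW)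
  have htr :=
    (Matrix.traceLinearMap (Fin 4) ℝ ℝ).toContinuousLinearMap.hasFDerivAt.comp_hasDerivAt t hm
  simp only [quadricMetric, covariantDeriv]
  refine htr.congr_deriv ?_
  change Matrix.trace (((-((g t)⁻¹ * g' * (g t)⁻¹) * V t + (g t)⁻¹ * V') * (g t)⁻¹ +
    ((g t)⁻¹ * V t) * -((g t)⁻¹ * g' * (g t)⁻¹)) * W t +
    ((g t)⁻¹ * V t * (g t)⁻¹) * W') = _
  have key := Matrix.trace_mul_comm ((g t)⁻¹ * V t * (g t)⁻¹ * W t) ((g t)⁻¹ * g')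
  simp [mul_add, add_mul, mul_sub, sub_mul, Matrix.trace_add, Matrix.trace_sub, mul_assoc] at key ⊢
  linarith

end MetricCompatibility

/-- The tension field of a map from the `(x, y)`-plane, with the Lorentz conformal structure
for which `x` and `y` are null (that of `2 dx dy`), to the space of quadrics: the trace
`∇_x g_y + ∇_y g_x` of its second fundamental form. -/
def tension (g : ℝ × ℝ → Mat4) (z : ℝ × ℝ) : Mat4 :=
  covariantDeriv (g z) (mdx g z) (mdy g z) (mdx (mdy g) z) +
    covariantDeriv (g z) (mdy g z) (mdx g z) (mdy (mdx g) z)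

/-- `g` is a Lorentz harmonic map from `D` to the space of quadrics. -/
def IsLorentzHarmonic (D : Set (ℝ × ℝ)) (g : ℝ × ℝ → Mat4) : Prop :=
  Set.MapsTo g D quadrics ∧ (∀ i j, ContDiffOn ℝ ∞ (fun z => g z i j) D) ∧
    ∀ z ∈ D, tension g z = 0

/-- The first-order Gauss map `g₁ = F J₁ Fᵗ` of a frame `F`. -/
def firstOrderGaussMap (F : ℝ × ℝ → Mat4) (z : ℝ × ℝ) : Mat4 :=
  F z * J₁ * (F z).transpose

/-! ### The family of connections -/

/-- The involution `τ₁(X) = - J₁ Xᵗ J₁` of the Lie algebra `sl₄ℝ`. -/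
def τ₁ (X : Mat4) : Mat4 := -(J₁ * X.transpose * J₁)

/-- The component in the fixed algebra of `τ₁`. -/
def kPart (X : Mat4) : Mat4 := (1 / 2 : ℝ) • (X + τ₁ X)

/-- The component in the `-1`-eigenspace of `τ₁`. -/
def pPart (X : Mat4) : Mat4 := (1 / 2 : ℝ) • (X - τ₁ X)

/-- The `dx`-coefficient `U^λ = U_𝔨 + λ⁻¹ U_𝔭` of `α^λ`, where `U = F⁻¹ F_x`. -/
def Ulam (F : ℝ × ℝ → Mat4) (lam : ℝ) (z : ℝ × ℝ) : Mat4 :=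
  kPart ((F z)⁻¹ * mdx F z) + lam⁻¹ • pPart ((F z)⁻¹ * mdx F z)

/-- The `dy`-coefficient `V^λ = V_𝔨 + λ V_𝔭` of `α^λ`, where `V = F⁻¹ F_y`. -/
def Vlam (F : ℝ × ℝ → Mat4) (lam : ℝ) (z : ℝ × ℝ) : Mat4 :=
  kPart ((F z)⁻¹ * mdy F z) + lam • pPart ((F z)⁻¹ * mdy F z)

/-- Flatness over `D` of the connection `d + α`, `α = A dx + B dy`:
`dα + ½ [α ∧ α] = (B_x - A_y + [A, B]) dx ∧ dy = 0`. -/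
def IsFlat (D : Set (ℝ × ℝ)) (A B : ℝ × ℝ → Mat4) : Prop :=
  ∀ z ∈ D, mdx B z - mdy A z + (A z * B z - B z * A z) = 0

end ProjSurf

end

noncomputable section

namespace ProjSurf

/-! ### Partial derivatives of smooth functions on an open set -/

section Calculus

variable {E : Type*} [NormedAddCommGroup E] [NormedSpace ℝ E]

/-! Write F⁻¹dF = U dx + V dy and split U and V along 𝔨₁ ⊕ 𝔭₁. Conditions 2 and 3 both reduce to the
vanishing of one matrix, H = (V_𝔭)_x + [U_𝔨, V_𝔭] (`harmonicDefect`), and this holds for any smooth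
frame of determinant one. The 𝔨-part of the Maurer-Cartan equation is the λ-independent term of the
curvature of α^λ, and its 𝔭-part says H = (U_𝔭)_y + [V_𝔨, U_𝔭]; so the curvature is (λ - λ⁻¹)H
(`curvature_family`). A tangent field F W J₁ Fᵗ along g₁ has Levi-Civita derivative F (W_x + [U_𝔨,
W]) J₁ Fᵗ in x, and (g₁)_y corresponds to W = 2V_𝔭; so the tension field is F(4H)J₁Fᵗ
(`tension_firstOrderGaussMap`).

For the Wilczynski frame put A = c_x/(2c) and B = b_y/(2b). Then U_𝔨 = diag(A, -A, A, -A), and the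
integrability conditions show that the entries of H are P_y, Q_x, cP_x + 2c_xP and zeros
(`harmonicDefect_frame`). They also identify the two Euler-Lagrange expressions, so H = 0 means:
projective minimal with P_y = Q_x = 0.

It remains to classify these surfaces (`demoulin_or_minimal_coincidence_iff`). Since P_y = 0 and
(c²P)_x = 0, the zero set of P is open as well as closed in the connected domain: P is identically
zero or nowhere zero. The same holds for Q, with (b²Q)_y = 0. If both vanish, the surface is
Demoulin. If P has no zero, equality of its mixed derivatives gives A_y = 0; then P_y = 0 becomes
(bc²)_x = 0, which forces B_x = 0, and Q_x = 0 becomes (b²c)_y = 0. The case of Q is symmetric.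

These two equations characterize coincidence surfaces: in coordinates X(x), Y(y) the coefficients
become bY'/X'² and cX'/Y'², and both equal 1 exactly when X'³ = b²c and Y'³ = bc². Conversely, on a
coincidence surface B_x = -2A_y and A_y = -2B_x, so both vanish and P_y = Q_x = 0 follows. -/

theorem differentiableAt_of_contDiffOn {D : Set (ℝ × ℝ)} {h : ℝ × ℝ → E} {z : ℝ × ℝ}
    (hh : ContDiffOn ℝ ∞ h D) (hD : IsOpen D) (hz : z ∈ D) : DifferentiableAt ℝ h z :=
  (hh.contDiffAt (hD.mem_nhds hz)).differentiableAt (by simp)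

theorem contDiffOn_pdx {D : Set (ℝ × ℝ)} {h : ℝ × ℝ → E}
    (hh : ContDiffOn ℝ ∞ h D) (hD : IsOpen D) : ContDiffOn ℝ ∞ (pdx h) D :=
  (hh.fderiv_of_isOpen hD (m := ∞) (by simp)).clm_apply contDiffOn_const

theorem contDiffOn_pdy {D : Set (ℝ × ℝ)} {h : ℝ × ℝ → E}
    (hh : ContDiffOn ℝ ∞ h D) (hD : IsOpen D) : ContDiffOn ℝ ∞ (pdy h) D :=
  (hh.fderiv_of_isOpen hD (m := ∞) (by simp)).clm_apply contDiffOn_const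

theorem pdx_congr {D : Set (ℝ × ℝ)} {g h : ℝ × ℝ → E} {z : ℝ × ℝ} (hD : IsOpen D) (hz : z ∈ D)
    (H : ∀ w ∈ D, g w = h w) : pdx g z = pdx h z := by
  have : g =ᶠ[nhds z] h := by
    filter_upwards [hD.mem_nhds hz] with w hw using H w hw
  simp only [pdx, this.fderiv_eq]

theorem pdy_congr {D : Set (ℝ × ℝ)} {g h : ℝ × ℝ → E} {z : ℝ × ℝ} (hD : IsOpen D) (hz : z ∈ D)
    (H : ∀ w ∈ D, g w = h w) : pdy g z = pdy h z := by
  have : g =ᶠ[nhds z] h := by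
    filter_upwards [hD.mem_nhds hz] with w hw using H w hw
  simp only [pdy, this.fderiv_eq]

theorem pdx_pdy_comm {D : Set (ℝ × ℝ)} {h : ℝ × ℝ → E} {z : ℝ × ℝ}
    (hh : ContDiffOn ℝ ∞ h D) (hD : IsOpen D) (hz : z ∈ D) :
    pdx (pdy h) z = pdy (pdx h) z := by
  have hc := hh.contDiffAt (hD.mem_nhds hz)
  have hs : IsSymmSndFDerivAt ℝ h z := hc.isSymmSndFDerivAt (by simpa using ENat.LEInfty.out)
  have hd : DifferentiableAt ℝ (fderiv ℝ h) z :=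
    (hc.fderiv_right (m := 1) (by norm_cast)).differentiableAt (by simp)
  have key : ∀ u v : ℝ × ℝ, fderiv ℝ (fun w => fderiv ℝ h w u) z v =
      fderiv ℝ (fderiv ℝ h) z v u := by
    intro u v
    rw [fderiv_clm_apply hd (differentiableAt_const u)]
    simp
  change fderiv ℝ (fun w => fderiv ℝ h w (0, 1)) z (1, 0) =
    fderiv ℝ (fun w => fderiv ℝ h w (1, 0)) z (0, 1)
  rw [key, key, hs.eq]

theorem pdx_const (e : E) (z : ℝ × ℝ) : pdx (fun _ => e) z = 0 := by simp [pdx]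

theorem pdy_const (e : E) (z : ℝ × ℝ) : pdy (fun _ => e) z = 0 := by simp [pdy]

theorem pdx_add {g h : ℝ × ℝ → E} {z : ℝ × ℝ} (hg : DifferentiableAt ℝ g z)
    (hh : DifferentiableAt ℝ h z) : pdx (fun w => g w + h w) z = pdx g z + pdx h z := by
  simp [pdx, fderiv_fun_add hg hh]

theorem pdy_add {g h : ℝ × ℝ → E} {z : ℝ × ℝ} (hg : DifferentiableAt ℝ g z)
    (hh : DifferentiableAt ℝ h z) : pdy (fun w => g w + h w) z = pdy g z + pdy h z := by
  simp [pdy, fderiv_fun_add hg hh]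

theorem pdx_sub {g h : ℝ × ℝ → E} {z : ℝ × ℝ} (hg : DifferentiableAt ℝ g z)
    (hh : DifferentiableAt ℝ h z) : pdx (fun w => g w - h w) z = pdx g z - pdx h z := by
  simp [pdx, fderiv_fun_sub hg hh]

theorem pdy_sub {g h : ℝ × ℝ → E} {z : ℝ × ℝ} (hg : DifferentiableAt ℝ g z)
    (hh : DifferentiableAt ℝ h z) : pdy (fun w => g w - h w) z = pdy g z - pdy h z := by
  simp [pdy, fderiv_fun_sub hg hh]

theorem pdx_neg (g : ℝ × ℝ → E) (z : ℝ × ℝ) : pdx (fun w => -g w) z = -pdx g z := by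
  simp [pdx, fderiv_fun_neg]

theorem pdy_neg (g : ℝ × ℝ → E) (z : ℝ × ℝ) : pdy (fun w => -g w) z = -pdy g z := by
  simp [pdy, fderiv_fun_neg]

theorem pdx_smul {r : ℝ × ℝ → ℝ} {h : ℝ × ℝ → E} {z : ℝ × ℝ} (hr : DifferentiableAt ℝ r z)
    (hh : DifferentiableAt ℝ h z) :
    pdx (fun w => r w • h w) z = r z • pdx h z + pdx r z • h z := by
  simp [pdx, fderiv_fun_smul hr hh]

theorem pdy_smul {r : ℝ × ℝ → ℝ} {h : ℝ × ℝ → E} {z : ℝ × ℝ} (hr : DifferentiableAt ℝ r z)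
    (hh : DifferentiableAt ℝ h z) :
    pdy (fun w => r w • h w) z = r z • pdy h z + pdy r z • h z := by
  simp [pdy, fderiv_fun_smul hr hh]

theorem pdx_mul {g h : ℝ × ℝ → ℝ} {z : ℝ × ℝ} (hg : DifferentiableAt ℝ g z)
    (hh : DifferentiableAt ℝ h z) :
    pdx (fun w => g w * h w) z = g z * pdx h z + pdx g z * h z :=
  pdx_smul hg hh

theorem pdy_mul {g h : ℝ × ℝ → ℝ} {z : ℝ × ℝ} (hg : DifferentiableAt ℝ g z)
    (hh : DifferentiableAt ℝ h z) :
    pdy (fun w => g w * h w) z = g z * pdy h z + pdy g z * h z :=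
  pdy_smul hg hh

theorem pdx_const_mul (r : ℝ) {h : ℝ × ℝ → ℝ} {z : ℝ × ℝ} (hh : DifferentiableAt ℝ h z) :
    pdx (fun w => r * h w) z = r * pdx h z := by
  rw [pdx_mul (differentiableAt_const r) hh, pdx_const, zero_mul, add_zero]

theorem pdy_const_mul (r : ℝ) {h : ℝ × ℝ → ℝ} {z : ℝ × ℝ} (hh : DifferentiableAt ℝ h z) :
    pdy (fun w => r * h w) z = r * pdy h z := by
  rw [pdy_mul (differentiableAt_const r) hh, pdy_const, zero_mul, add_zero]

theorem pdx_apply {ι : Type*} [Fintype ι] {h : ℝ × ℝ → ι → ℝ} {z : ℝ × ℝ}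
    (hh : DifferentiableAt ℝ h z) (i : ι) : pdx h z i = pdx (fun w => h w i) z := by
  simp only [pdx]
  rw [fderiv_apply hh]; rfl

theorem pdy_apply {ι : Type*} [Fintype ι] {h : ℝ × ℝ → ι → ℝ} {z : ℝ × ℝ}
    (hh : DifferentiableAt ℝ h z) (i : ι) : pdy h z i = pdy (fun w => h w i) z := by
  simp only [pdy]
  rw [fderiv_apply hh]; rfl

end Calculus

/-! ### Entrywise calculus of matrix-valued functions -/

/-- A matrix-valued function with smooth entries. -/
def EntrySmooth (D : Set (ℝ × ℝ)) (A : ℝ × ℝ → Mat4) : Prop :=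
  ∀ i j, ContDiffOn ℝ ∞ (fun z => A z i j) D

section MatrixCalculus

variable {D : Set (ℝ × ℝ)} {A B : ℝ × ℝ → Mat4} {z : ℝ × ℝ}

theorem EntrySmooth.mul (hA : EntrySmooth D A) (hB : EntrySmooth D B) :
    EntrySmooth D (fun z => A z * B z) := by
  intro i j
  simp only [Matrix.mul_apply]
  exact ContDiffOn.sum fun m _ => (hA i m).mul (hB m j)

theorem EntrySmooth.add (hA : EntrySmooth D A) (hB : EntrySmooth D B) :
    EntrySmooth D (fun z => A z + B z) := fun i j => (hA i j).add (hB i j)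

theorem EntrySmooth.sub (hA : EntrySmooth D A) (hB : EntrySmooth D B) :
    EntrySmooth D (fun z => A z - B z) := fun i j => (hA i j).sub (hB i j)

theorem EntrySmooth.smul (r : ℝ) (hA : EntrySmooth D A) :
    EntrySmooth D (fun z => r • A z) := fun i j => contDiffOn_const.mul (hA i j)

theorem EntrySmooth.transpose (hA : EntrySmooth D A) :
    EntrySmooth D (fun z => (A z).transpose) := fun i j => hA j i

theorem EntrySmooth.const (M : Mat4) : EntrySmooth D (fun _ => M) := fun _ _ => contDiffOn_const

theorem EntrySmooth.congr (hA : EntrySmooth D A) (H : ∀ w ∈ D, B w = A w) : EntrySmooth D B :=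
  fun i j => (hA i j).congr fun w hw => by rw [H w hw]

theorem mdx_congr (hD : IsOpen D) (hz : z ∈ D) (H : ∀ w ∈ D, A w = B w) :
    mdx A z = mdx B z := by
  ext i j
  exact pdx_congr hD hz fun w hw => by rw [H w hw]

theorem mdy_congr (hD : IsOpen D) (hz : z ∈ D) (H : ∀ w ∈ D, A w = B w) :
    mdy A z = mdy B z := by
  ext i j
  exact pdy_congr hD hz fun w hw => by rw [H w hw]

theorem mdx_mdy_comm (hA : EntrySmooth D A) (hD : IsOpen D) (hz : z ∈ D) :
    mdx (mdy A) z = mdy (mdx A) z := by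
  ext i j
  exact pdx_pdy_comm (hA i j) hD hz

theorem mdx_mul (hA : EntrySmooth D A) (hB : EntrySmooth D B) (hD : IsOpen D) (hz : z ∈ D) :
    mdx (fun w => A w * B w) z = mdx A z * B z + A z * mdx B z := by
  ext i j
  have hd : ∀ m, DifferentiableAt ℝ (fun w => A w i m * B w m j) z := fun m =>
    differentiableAt_of_contDiffOn ((hA i m).mul (hB m j)) hD hz
  have h1 : ∀ m, pdx (fun w => A w i m * B w m j) z =
      A z i m * pdx (fun w => B w m j) z + pdx (fun w => A w i m) z * B z m j := fun m =>
    pdx_mul (differentiableAt_of_contDiffOn (hA i m) hD hz)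
      (differentiableAt_of_contDiffOn (hB m j) hD hz)
  simp only [mdx, Matrix.of_apply, Matrix.mul_apply, Matrix.add_apply, ← Finset.sum_add_distrib]
  have h2 : pdx (fun w => ∑ m, A w i m * B w m j) z =
      ∑ m, pdx (fun w => A w i m * B w m j) z := by
    simp only [pdx]
    rw [fderiv_fun_sum fun m _ => hd m]
    simp
  rw [h2]
  exact Finset.sum_congr rfl fun m _ => by rw [h1, add_comm]

theorem mdy_mul (hA : EntrySmooth D A) (hB : EntrySmooth D B) (hD : IsOpen D) (hz : z ∈ D) :
    mdy (fun w => A w * B w) z = mdy A z * B z + A z * mdy B z := by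
  ext i j
  have hd : ∀ m, DifferentiableAt ℝ (fun w => A w i m * B w m j) z := fun m =>
    differentiableAt_of_contDiffOn ((hA i m).mul (hB m j)) hD hz
  have h1 : ∀ m, pdy (fun w => A w i m * B w m j) z =
      A z i m * pdy (fun w => B w m j) z + pdy (fun w => A w i m) z * B z m j := fun m =>
    pdy_mul (differentiableAt_of_contDiffOn (hA i m) hD hz)
      (differentiableAt_of_contDiffOn (hB m j) hD hz)
  simp only [mdy, Matrix.of_apply, Matrix.mul_apply, Matrix.add_apply, ← Finset.sum_add_distrib]
  have h2 : pdy (fun w => ∑ m, A w i m * B w m j) z =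
      ∑ m, pdy (fun w => A w i m * B w m j) z := by
    simp only [pdy]
    rw [fderiv_fun_sum fun m _ => hd m]
    simp
  rw [h2]
  exact Finset.sum_congr rfl fun m _ => by rw [h1, add_comm]

theorem mdx_add (hA : EntrySmooth D A) (hB : EntrySmooth D B) (hD : IsOpen D) (hz : z ∈ D) :
    mdx (fun w => A w + B w) z = mdx A z + mdx B z := by
  ext i j
  exact pdx_add (differentiableAt_of_contDiffOn (hA i j) hD hz)
    (differentiableAt_of_contDiffOn (hB i j) hD hz)

theorem mdy_add (hA : EntrySmooth D A) (hB : EntrySmooth D B) (hD : IsOpen D) (hz : z ∈ D) :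
    mdy (fun w => A w + B w) z = mdy A z + mdy B z := by
  ext i j
  exact pdy_add (differentiableAt_of_contDiffOn (hA i j) hD hz)
    (differentiableAt_of_contDiffOn (hB i j) hD hz)

theorem mdx_smul (r : ℝ) (hA : EntrySmooth D A) (hD : IsOpen D) (hz : z ∈ D) :
    mdx (fun w => r • A w) z = r • mdx A z := by
  ext i j
  exact pdx_const_mul r (differentiableAt_of_contDiffOn (hA i j) hD hz)

theorem mdy_smul (r : ℝ) (hA : EntrySmooth D A) (hD : IsOpen D) (hz : z ∈ D) :
    mdy (fun w => r • A w) z = r • mdy A z := by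
  ext i j
  exact pdy_const_mul r (differentiableAt_of_contDiffOn (hA i j) hD hz)

theorem mdx_transpose (A : ℝ × ℝ → Mat4) (z : ℝ × ℝ) :
    mdx (fun w => (A w).transpose) z = (mdx A z).transpose := rfl

theorem mdy_transpose (A : ℝ × ℝ → Mat4) (z : ℝ × ℝ) :
    mdy (fun w => (A w).transpose) z = (mdy A z).transpose := rfl

theorem mdx_const (M : Mat4) (z : ℝ × ℝ) : mdx (fun _ => M) z = 0 := by
  ext i j
  exact pdx_const _ _

theorem mdy_const (M : Mat4) (z : ℝ × ℝ) : mdy (fun _ => M) z = 0 := by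
  ext i j
  exact pdy_const _ _

end MatrixCalculus

/-! ### The involution -/

theorem J₁_mul_self : J₁ * J₁ = 1 := by
  ext i j
  fin_cases i <;> fin_cases j <;> simp [J₁, Matrix.mul_apply, Fin.sum_univ_four]

theorem J₁_transpose : J₁.transpose = J₁ := by
  ext i j
  fin_cases i <;> fin_cases j <;> simp [J₁]

theorem J₁_mul_J₁_mul (X : Mat4) : J₁ * (J₁ * X) = X := by
  rw [← mul_assoc, J₁_mul_self, one_mul]

theorem τ₁_add (X Y : Mat4) : τ₁ (X + Y) = τ₁ X + τ₁ Y := by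
  simp [τ₁, mul_add, add_mul, add_comm]

theorem τ₁_neg (X : Mat4) : τ₁ (-X) = -τ₁ X := by
  simp [τ₁]

theorem τ₁_sub (X Y : Mat4) : τ₁ (X - Y) = τ₁ X - τ₁ Y := by
  rw [sub_eq_add_neg, τ₁_add, τ₁_neg, ← sub_eq_add_neg]

/-- Transposition reverses products and the two inner copies of `J₁` cancel. The sign makes `τ₁`
compatible with commutators, which is all that the Lie algebra involution needs. -/
theorem τ₁_mul (X Y : Mat4) : τ₁ (X * Y) = -(τ₁ Y * τ₁ X) := by
  simp only [τ₁, Matrix.transpose_mul, neg_mul_neg, mul_assoc, J₁_mul_J₁_mul]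

/-- Carries the factor Uᵗ in (Fᵗ)_x = UᵗFᵗ across `J₁`, so that both terms in the derivative of F J₁
Fᵗ appear between F and J₁Fᵗ. -/
theorem J₁_mul_transpose (X : Mat4) : J₁ * X.transpose = -(τ₁ X * J₁) := by
  simp only [τ₁, neg_mul, neg_neg, mul_assoc, J₁_mul_self, mul_one]

section Flatness

variable {D : Set (ℝ × ℝ)} {F U V : ℝ × ℝ → Mat4} {z : ℝ × ℝ}

theorem EntrySmooth.τ₁ (hU : EntrySmooth D U) : EntrySmooth D (fun w => τ₁ (U w)) := by
  refine (((EntrySmooth.const J₁).mul hU.transpose).mul (EntrySmooth.const J₁)).smul (-1)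
    |>.congr fun w _ => ?_
  simp [ProjSurf.τ₁]

theorem mdx_τ₁ (hU : EntrySmooth D U) (hD : IsOpen D) (hz : z ∈ D) :
    mdx (fun w => τ₁ (U w)) z = τ₁ (mdx U z) := by
  have h1 : (fun w => τ₁ (U w)) = fun w => (-1 : ℝ) • (J₁ * (U w).transpose * J₁) := by
    funext w; simp [τ₁]
  have h2 := (EntrySmooth.const (D := D) J₁).mul hU.transpose
  rw [h1, mdx_smul _ (h2.mul (.const J₁)) hD hz, mdx_mul h2 (.const J₁) hD hz,
    mdx_mul (.const J₁) hU.transpose hD hz, mdx_const, mdx_transpose]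
  simp [τ₁]

theorem mdy_τ₁ (hU : EntrySmooth D U) (hD : IsOpen D) (hz : z ∈ D) :
    mdy (fun w => τ₁ (U w)) z = τ₁ (mdy U z) := by
  have h1 : (fun w => τ₁ (U w)) = fun w => (-1 : ℝ) • (J₁ * (U w).transpose * J₁) := by
    funext w; simp [τ₁]
  have h2 := (EntrySmooth.const (D := D) J₁).mul hU.transpose
  rw [h1, mdy_smul _ (h2.mul (.const J₁)) hD hz, mdy_mul h2 (.const J₁) hD hz,
    mdy_mul (.const J₁) hU.transpose hD hz, mdy_const, mdy_transpose]
  simp [τ₁]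

theorem EntrySmooth.kPart (hU : EntrySmooth D U) : EntrySmooth D (fun w => kPart (U w)) :=
  (hU.add hU.τ₁).smul _

theorem EntrySmooth.pPart (hU : EntrySmooth D U) : EntrySmooth D (fun w => pPart (U w)) :=
  (hU.sub hU.τ₁).smul _

theorem mdx_sub (hU : EntrySmooth D U) (hV : EntrySmooth D V) (hD : IsOpen D) (hz : z ∈ D) :
    mdx (fun w => U w - V w) z = mdx U z - mdx V z := by
  ext i j
  exact pdx_sub (differentiableAt_of_contDiffOn (hU i j) hD hz)
    (differentiableAt_of_contDiffOn (hV i j) hD hz)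

theorem mdy_sub (hU : EntrySmooth D U) (hV : EntrySmooth D V) (hD : IsOpen D) (hz : z ∈ D) :
    mdy (fun w => U w - V w) z = mdy U z - mdy V z := by
  ext i j
  exact pdy_sub (differentiableAt_of_contDiffOn (hU i j) hD hz)
    (differentiableAt_of_contDiffOn (hV i j) hD hz)

theorem mdx_kPart (hU : EntrySmooth D U) (hD : IsOpen D) (hz : z ∈ D) :
    mdx (fun w => kPart (U w)) z = kPart (mdx U z) := by
  simp only [kPart]
  rw [mdx_smul _ (hU.add hU.τ₁) hD hz, mdx_add hU hU.τ₁ hD hz, mdx_τ₁ hU hD hz]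

theorem mdy_kPart (hU : EntrySmooth D U) (hD : IsOpen D) (hz : z ∈ D) :
    mdy (fun w => kPart (U w)) z = kPart (mdy U z) := by
  simp only [kPart]
  rw [mdy_smul _ (hU.add hU.τ₁) hD hz, mdy_add hU hU.τ₁ hD hz, mdy_τ₁ hU hD hz]

theorem mdx_pPart (hU : EntrySmooth D U) (hD : IsOpen D) (hz : z ∈ D) :
    mdx (fun w => pPart (U w)) z = pPart (mdx U z) := by
  simp only [pPart]
  rw [mdx_smul _ (hU.sub hU.τ₁) hD hz, mdx_sub hU hU.τ₁ hD hz, mdx_τ₁ hU hD hz]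

theorem mdy_pPart (hU : EntrySmooth D U) (hD : IsOpen D) (hz : z ∈ D) :
    mdy (fun w => pPart (U w)) z = pPart (mdy U z) := by
  simp only [pPart]
  rw [mdy_smul _ (hU.sub hU.τ₁) hD hz, mdy_sub hU hU.τ₁ hD hz, mdy_τ₁ hU hD hz]

/-- The mixed derivative `(V_𝔭)_x + [U_𝔨, V_𝔭]`, whose vanishing expresses harmonicity. -/
def harmonicDefect (U V : ℝ × ℝ → Mat4) (z : ℝ × ℝ) : Mat4 :=
  pPart (mdx V z) + (kPart (U z) * pPart (V z) - pPart (V z) * kPart (U z))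

/-- For a flat connection `d + U dx + V dy`, the curvature of the family `α^λ` is a multiple of
the harmonic defect. -/
theorem curvature_family (hU : EntrySmooth D U) (hV : EntrySmooth D V) (hD : IsOpen D)
    (hz : z ∈ D) (hflat : mdx V z - mdy U z + (U z * V z - V z * U z) = 0) {lam : ℝ}
    (hlam : lam ≠ 0) :
    mdx (fun w => kPart (V w) + lam • pPart (V w)) z
        - mdy (fun w => kPart (U w) + lam⁻¹ • pPart (U w)) z
        + ((kPart (U z) + lam⁻¹ • pPart (U z)) * (kPart (V z) + lam • pPart (V z))
          - (kPart (V z) + lam • pPart (V z)) * (kPart (U z) + lam⁻¹ • pPart (U z)))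
      = (lam - lam⁻¹) • harmonicDefect U V z := by
  rw [mdx_add hV.kPart (hV.pPart.smul lam) hD hz, mdx_smul lam hV.pPart hD hz,
    mdx_kPart hV hD hz, mdx_pPart hV hD hz, mdy_add hU.kPart (hU.pPart.smul lam⁻¹) hD hz,
    mdy_smul _ hU.pPart hD hz, mdy_kPart hU hD hz, mdy_pPart hU hD hz]
  -- The flatness equation and its image under `τ₁` eliminate V_x. What remains is an identity
  -- between noncommutative monomials, checked coefficient by coefficient.
  have ha : mdx V z = mdy U z - (U z * V z - V z * U z) := by
    rw [← sub_eq_zero, ← hflat]; abel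
  have ha' : τ₁ (mdx V z) = τ₁ (mdy U z) - (τ₁ (U z) * τ₁ (V z) - τ₁ (V z) * τ₁ (U z)) := by
    rw [ha, τ₁_sub, τ₁_sub, τ₁_mul, τ₁_mul]; abel
  simp only [harmonicDefect, kPart, pPart]
  rw [ha', ha]
  simp only [mul_add, add_mul, mul_sub, sub_mul, smul_mul_assoc, mul_smul_comm, smul_add,
    smul_sub]
  match_scalars <;> field_simp <;> ring

/-- The harmonic defect in terms of `U_𝔭`. -/
theorem harmonicDefect_eq (hflat : mdx V z - mdy U z + (U z * V z - V z * U z) = 0) :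
    harmonicDefect U V z =
      pPart (mdy U z) + (kPart (V z) * pPart (U z) - pPart (U z) * kPart (V z)) := by
  have ha : mdx V z = mdy U z - (U z * V z - V z * U z) := by
    rw [← sub_eq_zero, ← hflat]; abel
  have ha' : τ₁ (mdx V z) = τ₁ (mdy U z) - (τ₁ (U z) * τ₁ (V z) - τ₁ (V z) * τ₁ (U z)) := by
    rw [ha, τ₁_sub, τ₁_sub, τ₁_mul, τ₁_mul]; abel
  simp only [harmonicDefect, kPart, pPart]
  rw [ha', ha]
  simp only [mul_add, add_mul, mul_sub, sub_mul, smul_mul_assoc, mul_smul_comm, smul_add,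
    smul_sub]
  match_scalars <;> norm_num

/-! ### Frames -/

theorem mul_eq_mul_of_frame (hdet : (F z).det = 1) {X Y : Mat4} (h : F z * X = F z * Y) :
    X = Y := by
  have hu : IsUnit (F z).det := by rw [hdet]; exact isUnit_one
  have := congrArg (fun M => (F z)⁻¹ * M) h
  simpa [← mul_assoc, Matrix.nonsing_inv_mul _ hu] using this

/-- The Maurer-Cartan equation of a frame. -/
theorem maurerCartan (hFs : EntrySmooth D F) (hU : EntrySmooth D U) (hV : EntrySmooth D V)
    (hD : IsOpen D) (hdet : ∀ w ∈ D, (F w).det = 1)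
    (hx : ∀ w ∈ D, mdx F w = F w * U w) (hy : ∀ w ∈ D, mdy F w = F w * V w) (hz : z ∈ D) :
    mdx V z - mdy U z + (U z * V z - V z * U z) = 0 := by
  -- Expanding F_xy = F_yx gives F(UV + V_x) and F(VU + U_y) up to order, from which F cancels.
  have h := mdx_mdy_comm hFs hD hz
  rw [mdx_congr hD hz hy, mdy_congr hD hz hx, mdx_mul hFs hV hD hz, mdy_mul hFs hU hD hz,
    hx z hz, hy z hz, mul_assoc, mul_assoc, ← mul_add, ← mul_add] at h
  have h' := mul_eq_mul_of_frame (hdet z hz) h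
  rw [← sub_eq_zero] at h'
  rw [← h']; abel

theorem firstOrderGaussMap_smooth (hFs : EntrySmooth D F) :
    EntrySmooth D (firstOrderGaussMap F) :=
  (hFs.mul (.const J₁)).mul hFs.transpose

/-- The coefficient U - τ₁(U) is 2U_𝔭: the 𝔨-part generates the stabilizer of `J₁` and does not move
the quadric. -/
theorem mdx_firstOrderGaussMap (hFs : EntrySmooth D F) (hD : IsOpen D)
    (hx : ∀ w ∈ D, mdx F w = F w * U w) (hz : z ∈ D) :
    mdx (firstOrderGaussMap F) z = F z * (U z - τ₁ (U z)) * J₁ * (F z).transpose := by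
  change mdx (fun w => F w * J₁ * (F w).transpose) z = _
  rw [mdx_mul (hFs.mul (.const J₁)) hFs.transpose hD hz, mdx_mul hFs (.const J₁) hD hz,
    mdx_const, mdx_transpose, hx z hz, Matrix.transpose_mul]
  have := J₁_mul_transpose (U z)
  rw [mul_zero, add_zero, mul_assoc (F z) J₁, ← mul_assoc J₁, this]
  noncomm_ring

theorem mdy_firstOrderGaussMap (hFs : EntrySmooth D F) (hD : IsOpen D)
    (hy : ∀ w ∈ D, mdy F w = F w * V w) (hz : z ∈ D) :
    mdy (firstOrderGaussMap F) z = F z * (V z - τ₁ (V z)) * J₁ * (F z).transpose := by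
  change mdy (fun w => F w * J₁ * (F w).transpose) z = _
  rw [mdy_mul (hFs.mul (.const J₁)) hFs.transpose hD hz, mdy_mul hFs (.const J₁) hD hz,
    mdy_const, mdy_transpose, hy z hz, Matrix.transpose_mul]
  have := J₁_mul_transpose (V z)
  rw [mul_zero, add_zero, mul_assoc (F z) J₁, ← mul_assoc J₁, this]
  noncomm_ring

/-- Second derivatives of g₁ come from this with W = V - τ₁(V), the frame coefficient of (g₁)_y. -/
theorem mdx_frame_conj {W : ℝ × ℝ → Mat4} (hFs : EntrySmooth D F) (hW : EntrySmooth D W)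
    (hD : IsOpen D) (hx : ∀ w ∈ D, mdx F w = F w * U w) (hz : z ∈ D) :
    mdx (fun w => F w * W w * J₁ * (F w).transpose) z =
      F z * (mdx W z + U z * W z - W z * τ₁ (U z)) * J₁ * (F z).transpose := by
  rw [mdx_mul ((hFs.mul hW).mul (.const J₁)) hFs.transpose hD hz,
    mdx_mul (hFs.mul hW) (.const J₁) hD hz, mdx_mul hFs hW hD hz,
    mdx_const, mdx_transpose, hx z hz, Matrix.transpose_mul]
  have := J₁_mul_transpose (U z)
  rw [mul_zero, add_zero, mul_assoc (F z * W z) J₁, ← mul_assoc J₁, this]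
  noncomm_ring

theorem mdy_frame_conj {W : ℝ × ℝ → Mat4} (hFs : EntrySmooth D F) (hW : EntrySmooth D W)
    (hD : IsOpen D) (hy : ∀ w ∈ D, mdy F w = F w * V w) (hz : z ∈ D) :
    mdy (fun w => F w * W w * J₁ * (F w).transpose) z =
      F z * (mdy W z + V z * W z - W z * τ₁ (V z)) * J₁ * (F z).transpose := by
  rw [mdy_mul ((hFs.mul hW).mul (.const J₁)) hFs.transpose hD hz,
    mdy_mul (hFs.mul hW) (.const J₁) hD hz, mdy_mul hFs hW hD hz,
    mdy_const, mdy_transpose, hy z hz, Matrix.transpose_mul]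
  have := J₁_mul_transpose (V z)
  rw [mul_zero, add_zero, mul_assoc (F z * W z) J₁, ← mul_assoc J₁, this]
  noncomm_ring

theorem firstOrderGaussMap_inv (hdet : (F z).det = 1) :
    (firstOrderGaussMap F z)⁻¹ = (F z)⁻¹.transpose * J₁ * (F z)⁻¹ := by
  have hu : IsUnit (F z).det := by rw [hdet]; exact isUnit_one
  refine Matrix.inv_eq_left_inv ?_
  have h1 : (F z)⁻¹ * F z = 1 := Matrix.nonsing_inv_mul _ hu
  have h2 : (F z)⁻¹.transpose * (F z).transpose = 1 := by
    rw [← Matrix.transpose_mul, Matrix.mul_nonsing_inv _ hu, Matrix.transpose_one]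
  calc (F z)⁻¹.transpose * J₁ * (F z)⁻¹ * firstOrderGaussMap F z
      = (F z)⁻¹.transpose * J₁ * ((F z)⁻¹ * F z) * J₁ * (F z).transpose := by
        simp only [firstOrderGaussMap, mul_assoc]
    _ = (F z)⁻¹.transpose * (J₁ * J₁) * (F z).transpose := by rw [h1]; noncomm_ring
    _ = 1 := by rw [J₁_mul_self, mul_one, h2]

/-- In frame coefficients the Christoffel term G g⁻¹ W becomes a plain matrix product, since J₁² =
1. -/
theorem frame_conj_mul (hdet : (F z).det = 1) (X Y : Mat4) :
    (F z * X * J₁ * (F z).transpose) * (firstOrderGaussMap F z)⁻¹ *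
        (F z * Y * J₁ * (F z).transpose) = F z * (X * Y) * J₁ * (F z).transpose := by
  have hu : IsUnit (F z).det := by rw [hdet]; exact isUnit_one
  rw [firstOrderGaussMap_inv hdet]
  have h1 : (F z)⁻¹ * F z = 1 := Matrix.nonsing_inv_mul _ hu
  have h2 : (F z).transpose * (F z)⁻¹.transpose = 1 := by
    rw [← Matrix.transpose_mul, h1, Matrix.transpose_one]
  calc _ = F z * X * J₁ * ((F z).transpose * (F z)⁻¹.transpose) * J₁ * ((F z)⁻¹ * F z) * Y * J₁ *
        (F z).transpose := by simp only [mul_assoc]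
    _ = F z * X * (J₁ * J₁) * Y * J₁ * (F z).transpose := by rw [h1, h2]; simp only [mul_assoc, mul_one]
    _ = _ := by rw [J₁_mul_self]; simp only [mul_assoc, one_mul]

/-- The Christoffel term removes U_𝔭 from U on the left and from -τ₁(U) on the right, so that W_x +
UW - Wτ₁(U) turns into W_x + [U_𝔨, W]. Each of the two covariant derivatives contributes 2H. -/
theorem tension_firstOrderGaussMap (hFs : EntrySmooth D F) (hU : EntrySmooth D U)
    (hV : EntrySmooth D V) (hD : IsOpen D) (hdet : ∀ w ∈ D, (F w).det = 1)
    (hx : ∀ w ∈ D, mdx F w = F w * U w) (hy : ∀ w ∈ D, mdy F w = F w * V w) (hz : z ∈ D) :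
    tension (firstOrderGaussMap F) z =
      F z * ((4 : ℝ) • harmonicDefect U V z) * J₁ * (F z).transpose := by
  have hflat := maurerCartan hFs hU hV hD hdet hx hy hz
  -- One half is kept in the form containing V_x, the other in the form containing U_y, to match the
  -- two summands of the tension. This is the only use of flatness here; the rest is formal algebra
  -- in independent symbols.
  have hE : (4 : ℝ) • harmonicDefect U V z = (2 : ℝ) • harmonicDefect U V z + (2 : ℝ) •
      (pPart (mdy U z) + (kPart (V z) * pPart (U z) - pPart (U z) * kPart (V z))) := by
    rw [← harmonicDefect_eq hflat]; module
  have hxy : mdx (mdy (firstOrderGaussMap F)) z = F z * ((mdx V z - τ₁ (mdx V z)) +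
      U z * (V z - τ₁ (V z)) - (V z - τ₁ (V z)) * τ₁ (U z)) * J₁ * (F z).transpose := by
    rw [mdx_congr hD hz (fun w hw => mdy_firstOrderGaussMap hFs hD hy hw),
      mdx_frame_conj hFs (hV.sub hV.τ₁) hD hx hz, mdx_sub hV hV.τ₁ hD hz, mdx_τ₁ hV hD hz]
  have hyx : mdy (mdx (firstOrderGaussMap F)) z = F z * ((mdy U z - τ₁ (mdy U z)) +
      V z * (U z - τ₁ (U z)) - (U z - τ₁ (U z)) * τ₁ (V z)) * J₁ * (F z).transpose := by
    rw [mdy_congr hD hz (fun w hw => mdx_firstOrderGaussMap hFs hD hx hw),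
      mdy_frame_conj hFs (hU.sub hU.τ₁) hD hy hz, mdy_sub hU hU.τ₁ hD hz, mdy_τ₁ hU hD hz]
  simp only [tension, covariantDeriv]
  rw [hxy, hyx, mdx_firstOrderGaussMap hFs hD hx hz, mdy_firstOrderGaussMap hFs hD hy hz,
    frame_conj_mul (hdet z hz), frame_conj_mul (hdet z hz), hE]
  simp only [harmonicDefect, kPart, pPart]
  generalize mdx V z = a, mdy U z = b at *
  generalize τ₁ a = a', τ₁ b = b', τ₁ (U z) = u', τ₁ (V z) = v', U z = u, V z = v at *
  simp only [mul_add, add_mul, mul_sub, sub_mul, smul_mul_assoc, mul_smul_comm, smul_add,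
    smul_sub, ← mul_assoc]
  match_scalars <;> norm_num

theorem tension_eq_zero_iff (hFs : EntrySmooth D F) (hU : EntrySmooth D U)
    (hV : EntrySmooth D V) (hD : IsOpen D) (hdet : ∀ w ∈ D, (F w).det = 1)
    (hx : ∀ w ∈ D, mdx F w = F w * U w) (hy : ∀ w ∈ D, mdy F w = F w * V w) (hz : z ∈ D) :
    tension (firstOrderGaussMap F) z = 0 ↔ harmonicDefect U V z = 0 := by
  rw [tension_firstOrderGaussMap hFs hU hV hD hdet hx hy hz]
  refine ⟨fun h => ?_, fun h => by rw [h]; simp⟩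
  have hu : IsUnit (F z).det := by rw [hdet z hz]; exact isUnit_one
  have h1 : (F z)⁻¹ * F z = 1 := Matrix.nonsing_inv_mul _ hu
  have h2 : (F z).transpose * (F z)⁻¹.transpose = 1 := by
    rw [← Matrix.transpose_mul, h1, Matrix.transpose_one]
  have h3 : (4 : ℝ) • harmonicDefect U V z = 0 := by
    calc (4 : ℝ) • harmonicDefect U V z
        = ((F z)⁻¹ * F z) * ((4 : ℝ) • harmonicDefect U V z) * J₁ *
            ((F z).transpose * (F z)⁻¹.transpose) * J₁ := by
          rw [h1, h2, one_mul, mul_one, mul_assoc, J₁_mul_self, mul_one]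
      _ = (F z)⁻¹ * (F z * ((4 : ℝ) • harmonicDefect U V z) * J₁ * (F z).transpose) *
            (F z)⁻¹.transpose * J₁ := by simp only [mul_assoc]
      _ = 0 := by rw [h]; simp
  exact (smul_eq_zero.1 h3).resolve_left (by norm_num)

theorem firstOrderGaussMap_mem_quadrics (hdet : (F z).det = 1) :
    firstOrderGaussMap F z ∈ quadrics := by
  have hJ : J₁.det = 1 := by
    simp [J₁, Matrix.det_succ_row_zero, Fin.sum_univ_succ, Fin.succAbove]
    norm_num
  -- The columns are e₀ + e₃/2, e₁ + e₂/2, e₁ - e₂/2, e₀ - e₃/2. The differences of squares pair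
  -- them into e₀e₃ᵗ + e₃e₀ᵗ and e₁e₂ᵗ + e₂e₁ᵗ, whose sum is `J₁`.
  refine ⟨?_, ?_, F z * !![1, 0, 0, 1; 0, 1, 1, 0; 0, 1/2, -(1/2), 0; 1/2, 0, 0, -(1/2)], ?_, ?_⟩
  · simp only [Matrix.IsSymm, firstOrderGaussMap, Matrix.transpose_mul, Matrix.transpose_transpose,
      J₁_transpose, mul_assoc]
  · simp only [firstOrderGaussMap, Matrix.det_mul, Matrix.det_transpose, hdet, hJ, mul_one]
  · rw [Matrix.det_mul, hdet, one_mul, isUnit_iff_ne_zero]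
    simp [Matrix.det_succ_row_zero, Fin.sum_univ_succ, Fin.succAbove]
    norm_num
  · simp only [firstOrderGaussMap, Matrix.transpose_mul, ← mul_assoc]
    congr 1
    simp only [mul_assoc]
    congr 1
    ext i j
    fin_cases i <;> fin_cases j <;>
      simp [J₁, Matrix.mul_apply, Fin.sum_univ_four, Matrix.diagonal_apply] <;> norm_num

theorem isLorentzHarmonic_iff (hFs : EntrySmooth D F) (hU : EntrySmooth D U)
    (hV : EntrySmooth D V) (hD : IsOpen D) (hdet : ∀ w ∈ D, (F w).det = 1)
    (hx : ∀ w ∈ D, mdx F w = F w * U w) (hy : ∀ w ∈ D, mdy F w = F w * V w) :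
    IsLorentzHarmonic D (firstOrderGaussMap F) ↔ ∀ z ∈ D, harmonicDefect U V z = 0 := by
  refine ⟨fun h z hz => (tension_eq_zero_iff hFs hU hV hD hdet hx hy hz).1 (h.2.2 z hz),
    fun h => ⟨fun z hz => firstOrderGaussMap_mem_quadrics (hdet z hz),
      firstOrderGaussMap_smooth hFs, fun z hz =>
        (tension_eq_zero_iff hFs hU hV hD hdet hx hy hz).2 (h z hz)⟩⟩

theorem inv_mul_eq_of_frame {W : Mat4} (hdet : (F z).det = 1) : (F z)⁻¹ * (F z * W) = W := by
  have hu : IsUnit (F z).det := by rw [hdet]; exact isUnit_one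
  rw [← mul_assoc, Matrix.nonsing_inv_mul _ hu, one_mul]

theorem isFlat_family_iff (hFs : EntrySmooth D F) (hU : EntrySmooth D U)
    (hV : EntrySmooth D V) (hD : IsOpen D) (hdet : ∀ w ∈ D, (F w).det = 1)
    (hx : ∀ w ∈ D, mdx F w = F w * U w) (hy : ∀ w ∈ D, mdy F w = F w * V w) :
    (∀ lam : ℝ, lam ≠ 0 → IsFlat D (Ulam F lam) (Vlam F lam)) ↔
      ∀ z ∈ D, harmonicDefect U V z = 0 := by
  have key : ∀ lam : ℝ, lam ≠ 0 → ∀ z ∈ D,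
      mdx (Vlam F lam) z - mdy (Ulam F lam) z +
        (Ulam F lam z * Vlam F lam z - Vlam F lam z * Ulam F lam z) =
        (lam - lam⁻¹) • harmonicDefect U V z := by
    intro lam hlam z hz
    have hUl : ∀ w ∈ D, Ulam F lam w = kPart (U w) + lam⁻¹ • pPart (U w) := fun w hw => by
      simp only [Ulam, hx w hw, inv_mul_eq_of_frame (hdet w hw)]
    have hVl : ∀ w ∈ D, Vlam F lam w = kPart (V w) + lam • pPart (V w) := fun w hw => by
      simp only [Vlam, hy w hw, inv_mul_eq_of_frame (hdet w hw)]
    rw [mdx_congr hD hz hVl, mdy_congr hD hz hUl, hUl z hz, hVl z hz]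
    exact curvature_family hU hV hD hz (maurerCartan hFs hU hV hD hdet hx hy hz) hlam
  refine ⟨fun h z hz => ?_, fun h lam hlam z hz => by rw [key lam hlam z hz, h z hz, smul_zero]⟩
  -- Any λ with λ² ≠ 1 would do; at λ = ±1 the curvature (λ - λ⁻¹)H vanishes in any case.
  have h2 := h 2 two_ne_zero z hz
  rw [key 2 two_ne_zero z hz] at h2
  exact (smul_eq_zero.1 h2).resolve_left (by norm_num)

end Flatness

/-! ### The structure equations of the Wilczynski frame -/

/-- The function `c_x / (2c)`. -/
def coefA (c : ℝ × ℝ → ℝ) (z : ℝ × ℝ) : ℝ := pdx c z / (2 * c z)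

/-- The function `b_y / (2b)`. -/
def coefB (b : ℝ × ℝ → ℝ) (z : ℝ × ℝ) : ℝ := pdy b z / (2 * b z)

/-- The function `k = (bc - (log b)_xy) / 2`. -/
def coefK (b c : ℝ × ℝ → ℝ) (z : ℝ × ℝ) : ℝ := b z * c z / 2 - pdx (coefB b) z

/-- The function `l = (bc - (log c)_xy) / 2`. -/
def coefL (b c : ℝ × ℝ → ℝ) (z : ℝ × ℝ) : ℝ := b z * c z / 2 - pdy (coefA c) z

/-- The coefficient of `f` in `η_x`. -/
def coefX (b c p q : ℝ × ℝ → ℝ) (z : ℝ × ℝ) : ℝ :=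
  b z * q z + pdy p z + b z * coefB b z ^ 2 - pdx b z * c z / 2 - b z * c z * coefA c z

/-- The coefficient of `f` in `η_y`. -/
def coefY (b c p q : ℝ × ℝ → ℝ) (z : ℝ × ℝ) : ℝ :=
  c z * p z + pdx q z + c z * coefA c z ^ 2 - pdy c z * b z / 2 - b z * c z * coefB b z

/-- The coefficient matrix `U = F⁻¹ F_x` of the Wilczynski frame. -/
def frameU (b c p q : ℝ × ℝ → ℝ) (z : ℝ × ℝ) : Mat4 :=
  !![coefA c z, invP b c p z, coefK b c z, coefX b c p q z;
     1, -coefA c z, 0, coefK b c z;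
     0, b z, coefA c z, invP b c p z;
     0, 0, 1, -coefA c z]

/-- The coefficient matrix `V = F⁻¹ F_y` of the Wilczynski frame. -/
def frameV (b c p q : ℝ × ℝ → ℝ) (z : ℝ × ℝ) : Mat4 :=
  !![coefB b z, coefL b c z, invQ b c q z, coefY b c p q z;
     0, coefB b z, c z, invQ b c q z;
     1, 0, -coefB b z, coefL b c z;
     0, 1, 0, -coefB b z]

/-- A row of the Wilczynski frame, in terms of one coordinate function of the lift. -/
def frameRow (b c φ : ℝ × ℝ → ℝ) (z : ℝ × ℝ) : Fin 4 → ℝ :=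
  ![φ z, pdx φ z - coefA c z * φ z, pdy φ z - coefB b z * φ z,
    pdx (pdy φ) z - coefA c z * pdy φ z - coefB b z * pdx φ z
      + (coefA c z * coefB b z - b z * c z / 2) * φ z]

/-- A smooth scalar solution of the canonical system with nonvanishing `b` and `c`. -/
structure ScalarSystem (D : Set (ℝ × ℝ)) (b c p q φ : ℝ × ℝ → ℝ) : Prop where
  isOpen : IsOpen D
  ne_b : ∀ z ∈ D, b z ≠ 0
  ne_c : ∀ z ∈ D, c z ≠ 0
  smooth_b : ContDiffOn ℝ ∞ b D
  smooth_c : ContDiffOn ℝ ∞ c D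
  smooth_p : ContDiffOn ℝ ∞ p D
  smooth_q : ContDiffOn ℝ ∞ q D
  smooth : ContDiffOn ℝ ∞ φ D
  eq_xx : ∀ z ∈ D, pdx (pdx φ) z = b z * pdy φ z + p z * φ z
  eq_yy : ∀ z ∈ D, pdy (pdy φ) z = c z * pdx φ z + q z * φ z

/-! ### Logarithmic derivatives and smoothness of the coefficients. -/

section Coefficients

variable {D : Set (ℝ × ℝ)} {b c p q : ℝ × ℝ → ℝ} {z : ℝ × ℝ}

theorem contDiffOn_coefA (hc : ContDiffOn ℝ ∞ c D) (hD : IsOpen D) (h0 : ∀ z ∈ D, c z ≠ 0) :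
    ContDiffOn ℝ ∞ (coefA c) D :=
  (contDiffOn_pdx hc hD).div (contDiffOn_const.mul hc) fun z hz => mul_ne_zero two_ne_zero (h0 z hz)

theorem contDiffOn_coefB (hb : ContDiffOn ℝ ∞ b D) (hD : IsOpen D) (h0 : ∀ z ∈ D, b z ≠ 0) :
    ContDiffOn ℝ ∞ (coefB b) D :=
  (contDiffOn_pdy hb hD).div (contDiffOn_const.mul hb) fun z hz => mul_ne_zero two_ne_zero (h0 z hz)

/-- Trading derivatives of c and b for A and B removes denominators, so that later identities are
polynomial. -/
theorem pdx_eq_coefA (h0 : c z ≠ 0) : pdx c z = 2 * c z * coefA c z := by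
  unfold coefA; field_simp

theorem pdy_eq_coefB (h0 : b z ≠ 0) : pdy b z = 2 * b z * coefB b z := by
  unfold coefB; field_simp

theorem pdx_pdx_eq_coefA (hc : ContDiffOn ℝ ∞ c D) (hD : IsOpen D) (h0 : ∀ z ∈ D, c z ≠ 0)
    (hz : z ∈ D) :
    pdx (pdx c) z = 2 * c z * pdx (coefA c) z + 4 * c z * coefA c z ^ 2 := by
  have hA := differentiableAt_of_contDiffOn (contDiffOn_coefA hc hD h0) hD hz
  have hc' := differentiableAt_of_contDiffOn hc hD hz
  rw [pdx_congr hD hz fun w hw => pdx_eq_coefA (h0 w hw),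
    pdx_mul (hc'.const_mul 2) hA, pdx_const_mul 2 hc', pdx_eq_coefA (h0 z hz)]
  ring

theorem pdy_pdy_eq_coefB (hb : ContDiffOn ℝ ∞ b D) (hD : IsOpen D) (h0 : ∀ z ∈ D, b z ≠ 0)
    (hz : z ∈ D) :
    pdy (pdy b) z = 2 * b z * pdy (coefB b) z + 4 * b z * coefB b z ^ 2 := by
  have hB := differentiableAt_of_contDiffOn (contDiffOn_coefB hb hD h0) hD hz
  have hb' := differentiableAt_of_contDiffOn hb hD hz
  rw [pdy_congr hD hz fun w hw => pdy_eq_coefB (h0 w hw),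
    pdy_mul (hb'.const_mul 2) hB, pdy_const_mul 2 hb', pdy_eq_coefB (h0 z hz)]
  ring

/-- From c_xx = 2cA_x + 4cA² one gets c_xx/(2c) - c_x²/(4c²) = A_x + A². -/
theorem invP_eq (hc : ContDiffOn ℝ ∞ c D) (hD : IsOpen D)
    (hb0 : ∀ z ∈ D, b z ≠ 0) (hc0 : ∀ z ∈ D, c z ≠ 0) (hz : z ∈ D) :
    invP b c p z = p z + b z * coefB b z - pdx (coefA c) z - coefA c z ^ 2 := by
  have := hc0 z hz
  rw [invP, pdx_pdx_eq_coefA hc hD hc0 hz, pdy_eq_coefB (hb0 z hz), pdx_eq_coefA (hc0 z hz)]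
  field_simp
  ring

theorem invQ_eq (hb : ContDiffOn ℝ ∞ b D) (hD : IsOpen D)
    (hb0 : ∀ z ∈ D, b z ≠ 0) (hc0 : ∀ z ∈ D, c z ≠ 0) (hz : z ∈ D) :
    invQ b c q z = q z + c z * coefA c z - pdy (coefB b) z - coefB b z ^ 2 := by
  have := hb0 z hz
  rw [invQ, pdy_pdy_eq_coefB hb hD hb0 hz, pdy_eq_coefB (hb0 z hz), pdx_eq_coefA (hc0 z hz)]
  field_simp
  ring

theorem contDiffOn_invP (hb : ContDiffOn ℝ ∞ b D) (hc : ContDiffOn ℝ ∞ c D)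
    (hp : ContDiffOn ℝ ∞ p D) (hD : IsOpen D)
    (hb0 : ∀ z ∈ D, b z ≠ 0) (hc0 : ∀ z ∈ D, c z ≠ 0) : ContDiffOn ℝ ∞ (invP b c p) D :=
  (((hp.add (hb.mul (contDiffOn_coefB hb hD hb0))).sub
    (contDiffOn_pdx (contDiffOn_coefA hc hD hc0) hD)).sub
      ((contDiffOn_coefA hc hD hc0).pow 2)).congr fun _ hz => invP_eq hc hD hb0 hc0 hz

theorem contDiffOn_invQ (hb : ContDiffOn ℝ ∞ b D) (hc : ContDiffOn ℝ ∞ c D)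
    (hq : ContDiffOn ℝ ∞ q D) (hD : IsOpen D)
    (hb0 : ∀ z ∈ D, b z ≠ 0) (hc0 : ∀ z ∈ D, c z ≠ 0) : ContDiffOn ℝ ∞ (invQ b c q) D :=
  (((hq.add (hc.mul (contDiffOn_coefA hc hD hc0))).sub
    (contDiffOn_pdy (contDiffOn_coefB hb hD hb0) hD)).sub
      ((contDiffOn_coefB hb hD hb0).pow 2)).congr fun _ hz => invQ_eq hb hD hb0 hc0 hz

theorem contDiffOn_coefK (hb : ContDiffOn ℝ ∞ b D) (hc : ContDiffOn ℝ ∞ c D) (hD : IsOpen D)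
    (hb0 : ∀ z ∈ D, b z ≠ 0) : ContDiffOn ℝ ∞ (coefK b c) D :=
  ((hb.mul hc).div_const 2).sub (contDiffOn_pdx (contDiffOn_coefB hb hD hb0) hD)

theorem contDiffOn_coefL (hb : ContDiffOn ℝ ∞ b D) (hc : ContDiffOn ℝ ∞ c D) (hD : IsOpen D)
    (hc0 : ∀ z ∈ D, c z ≠ 0) : ContDiffOn ℝ ∞ (coefL b c) D :=
  ((hb.mul hc).div_const 2).sub (contDiffOn_pdy (contDiffOn_coefA hc hD hc0) hD)

theorem contDiffOn_coefX (hb : ContDiffOn ℝ ∞ b D) (hc : ContDiffOn ℝ ∞ c D)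
    (hp : ContDiffOn ℝ ∞ p D) (hq : ContDiffOn ℝ ∞ q D) (hD : IsOpen D)
    (hb0 : ∀ z ∈ D, b z ≠ 0) (hc0 : ∀ z ∈ D, c z ≠ 0) : ContDiffOn ℝ ∞ (coefX b c p q) D :=
  ((((hb.mul hq).add (contDiffOn_pdy hp hD)).add
    (hb.mul ((contDiffOn_coefB hb hD hb0).pow 2))).sub
      (((contDiffOn_pdx hb hD).mul hc).div_const 2)).sub
        ((hb.mul hc).mul (contDiffOn_coefA hc hD hc0))

theorem contDiffOn_coefY (hb : ContDiffOn ℝ ∞ b D) (hc : ContDiffOn ℝ ∞ c D)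
    (hp : ContDiffOn ℝ ∞ p D) (hq : ContDiffOn ℝ ∞ q D) (hD : IsOpen D)
    (hb0 : ∀ z ∈ D, b z ≠ 0) (hc0 : ∀ z ∈ D, c z ≠ 0) : ContDiffOn ℝ ∞ (coefY b c p q) D :=
  ((((hc.mul hp).add (contDiffOn_pdx hq hD)).add
    (hc.mul ((contDiffOn_coefA hc hD hc0).pow 2))).sub
      (((contDiffOn_pdy hc hD).mul hb).div_const 2)).sub
        ((hb.mul hc).mul (contDiffOn_coefB hb hD hb0))

theorem entrySmooth_frameU (hb : ContDiffOn ℝ ∞ b D) (hc : ContDiffOn ℝ ∞ c D)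
    (hp : ContDiffOn ℝ ∞ p D) (hq : ContDiffOn ℝ ∞ q D) (hD : IsOpen D)
    (hb0 : ∀ z ∈ D, b z ≠ 0) (hc0 : ∀ z ∈ D, c z ≠ 0) : EntrySmooth D (frameU b c p q) := by
  have h1 := contDiffOn_coefA hc hD hc0
  have h2 := contDiffOn_invP hb hc hp hD hb0 hc0
  have h3 := contDiffOn_coefK hb hc hD hb0
  have h4 := contDiffOn_coefX hb hc hp hq hD hb0 hc0
  intro i j
  fin_cases i <;> fin_cases j
  exacts [h1, h2, h3, h4, contDiffOn_const, h1.neg, contDiffOn_const, h3, contDiffOn_const, hb, h1,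
    h2, contDiffOn_const, contDiffOn_const, contDiffOn_const, h1.neg]

theorem entrySmooth_frameV (hb : ContDiffOn ℝ ∞ b D) (hc : ContDiffOn ℝ ∞ c D)
    (hp : ContDiffOn ℝ ∞ p D) (hq : ContDiffOn ℝ ∞ q D) (hD : IsOpen D)
    (hb0 : ∀ z ∈ D, b z ≠ 0) (hc0 : ∀ z ∈ D, c z ≠ 0) : EntrySmooth D (frameV b c p q) := by
  have h1 := contDiffOn_coefB hb hD hb0
  have h2 := contDiffOn_invQ hb hc hq hD hb0 hc0
  have h3 := contDiffOn_coefL hb hc hD hc0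
  have h4 := contDiffOn_coefY hb hc hp hq hD hb0 hc0
  intro i j
  fin_cases i <;> fin_cases j
  exacts [h1, h3, h2, h4, contDiffOn_const, h1, hc, h2, contDiffOn_const, contDiffOn_const, h1.neg,
    h3, contDiffOn_const, contDiffOn_const, contDiffOn_const, h1.neg]

end Coefficients

/-! ### Derivatives of one row of the frame. -/

namespace ScalarSystem

variable {D : Set (ℝ × ℝ)} {b c p q φ : ℝ × ℝ → ℝ} {z : ℝ × ℝ}

/-- The third derivative in η_x, obtained by differentiating the first equation of the system in y.
-/
theorem pdx_pdx_pdy (h : ScalarSystem D b c p q φ) (hz : z ∈ D) :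
    pdx (pdx (pdy φ)) z =
      b z * pdy (pdy φ) z + pdy b z * pdy φ z + (p z * pdy φ z + pdy p z * φ z) := by
  have hD := h.isOpen
  have d {E : Type} [NormedAddCommGroup E] [NormedSpace ℝ E] {g : ℝ × ℝ → E}
    (hg : ContDiffOn ℝ ∞ g D) := differentiableAt_of_contDiffOn hg hD hz
  have hy := contDiffOn_pdy h.smooth hD
  rw [pdx_congr hD hz fun w hw => pdx_pdy_comm h.smooth hD hw,
    pdx_pdy_comm (contDiffOn_pdx h.smooth hD) hD hz, pdy_congr hD hz h.eq_xx,
    pdy_add (d (h.smooth_b.mul hy)) (d (h.smooth_p.mul h.smooth)),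
    pdy_mul (d h.smooth_b) (d hy), pdy_mul (d h.smooth_p) (d h.smooth)]

theorem pdy_pdx_pdy (h : ScalarSystem D b c p q φ) (hz : z ∈ D) :
    pdy (pdx (pdy φ)) z =
      c z * pdx (pdx φ) z + pdx c z * pdx φ z + (q z * pdx φ z + pdx q z * φ z) := by
  have hD := h.isOpen
  have d {E : Type} [NormedAddCommGroup E] [NormedSpace ℝ E] {g : ℝ × ℝ → E}
    (hg : ContDiffOn ℝ ∞ g D) := differentiableAt_of_contDiffOn hg hD hz
  have hx := contDiffOn_pdx h.smooth hD
  rw [← pdx_pdy_comm (contDiffOn_pdy h.smooth hD) hD hz, pdx_congr hD hz h.eq_yy,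
    pdx_add (d (h.smooth_c.mul hx)) (d (h.smooth_q.mul h.smooth)),
    pdx_mul (d h.smooth_c) (d hx), pdx_mul (d h.smooth_q) (d h.smooth)]

theorem contDiffOn_frameRow (h : ScalarSystem D b c p q φ) (j : Fin 4) :
    ContDiffOn ℝ ∞ (fun z => frameRow b c φ z j) D := by
  have hA := contDiffOn_coefA h.smooth_c h.isOpen h.ne_c
  have hB := contDiffOn_coefB h.smooth_b h.isOpen h.ne_b
  have hx := contDiffOn_pdx h.smooth h.isOpen
  have hy := contDiffOn_pdy h.smooth h.isOpen
  have hxy := contDiffOn_pdx hy h.isOpen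
  fin_cases j
  · exact h.smooth
  · exact hx.sub (hA.mul h.smooth)
  · exact hy.sub (hB.mul h.smooth)
  · exact ((hxy.sub (hA.mul hy)).sub (hB.mul hx)).add
      (((hA.mul hB).sub ((h.smooth_b.mul h.smooth_c).div_const 2)).mul h.smooth)

/-- Each derivative is reduced by the system to the basis φ, φ_x, φ_y, φ_xy and regrouped in the
frame. The identity for X = bQ is not available yet, so the last entry stays in the raw form
`coefX`. -/
theorem pdx_frameRow (h : ScalarSystem D b c p q φ) (hz : z ∈ D) (j : Fin 4) :
    pdx (fun w => frameRow b c φ w j) z = ∑ m, frameRow b c φ z m * frameU b c p q z m j := by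
  have hD := h.isOpen
  have d {g : ℝ × ℝ → ℝ} (hg : ContDiffOn ℝ ∞ g D) := differentiableAt_of_contDiffOn hg hD hz
  have hA := contDiffOn_coefA h.smooth_c h.isOpen h.ne_c
  have hB := contDiffOn_coefB h.smooth_b h.isOpen h.ne_b
  have hx := contDiffOn_pdx h.smooth h.isOpen
  have hy := contDiffOn_pdy h.smooth h.isOpen
  have hxy := contDiffOn_pdx hy h.isOpen
  have hbc := (h.smooth_b.mul h.smooth_c).div_const 2
  have hP := invP_eq (p := p) h.smooth_c hD h.ne_b h.ne_c hz
  have hbc' : pdx (fun w => b w * c w / 2) z = (b z * pdx c z + pdx b z * c z) / 2 := by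
    simp only [div_eq_inv_mul]
    rw [pdx_const_mul _ (d (h.smooth_b.mul h.smooth_c)), pdx_mul (d h.smooth_b) (d h.smooth_c)]
  fin_cases j
  · change pdx φ z = _
    simp [frameRow, frameU, Fin.sum_univ_four]
    ring
  · change pdx (fun w => pdx φ w - coefA c w * φ w) z = _
    rw [pdx_sub (d hx) (d (hA.mul h.smooth)), pdx_mul (d hA) (d h.smooth), h.eq_xx z hz]
    simp [frameRow, frameU, Fin.sum_univ_four, hP]
    ring
  · change pdx (fun w => pdy φ w - coefB b w * φ w) z = _
    rw [pdx_sub (d hy) (d (hB.mul h.smooth)), pdx_mul (d hB) (d h.smooth)]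
    simp [frameRow, frameU, Fin.sum_univ_four, coefK]
    ring
  · change pdx (fun w => pdx (pdy φ) w - coefA c w * pdy φ w - coefB b w * pdx φ w
      + (coefA c w * coefB b w - b w * c w / 2) * φ w) z = _
    rw [pdx_add (d ((hxy.sub (hA.mul hy)).sub (hB.mul hx)))
        (d (((hA.mul hB).sub hbc).mul h.smooth)),
      pdx_sub (d (hxy.sub (hA.mul hy))) (d (hB.mul hx)), pdx_sub (d hxy) (d (hA.mul hy)),
      pdx_mul (d hA) (d hy), pdx_mul (d hB) (d hx),
      pdx_mul (d ((hA.mul hB).sub hbc)) (d h.smooth), pdx_sub (d (hA.mul hB)) (d hbc),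
      pdx_mul (d hA) (d hB), hbc', h.pdx_pdx_pdy hz, h.eq_xx z hz, h.eq_yy z hz,
      pdx_eq_coefA (h.ne_c z hz), pdy_eq_coefB (h.ne_b z hz)]
    simp [frameRow, frameU, Fin.sum_univ_four, coefK, coefX, hP]
    ring

theorem pdy_frameRow (h : ScalarSystem D b c p q φ) (hz : z ∈ D) (j : Fin 4) :
    pdy (fun w => frameRow b c φ w j) z = ∑ m, frameRow b c φ z m * frameV b c p q z m j := by
  have hD := h.isOpen
  have d {g : ℝ × ℝ → ℝ} (hg : ContDiffOn ℝ ∞ g D) := differentiableAt_of_contDiffOn hg hD hz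
  have hA := contDiffOn_coefA h.smooth_c h.isOpen h.ne_c
  have hB := contDiffOn_coefB h.smooth_b h.isOpen h.ne_b
  have hx := contDiffOn_pdx h.smooth h.isOpen
  have hy := contDiffOn_pdy h.smooth h.isOpen
  have hxy := contDiffOn_pdx hy h.isOpen
  have hbc := (h.smooth_b.mul h.smooth_c).div_const 2
  have hQ := invQ_eq (q := q) h.smooth_b hD h.ne_b h.ne_c hz
  have hbc' : pdy (fun w => b w * c w / 2) z = (b z * pdy c z + pdy b z * c z) / 2 := by
    simp only [div_eq_inv_mul]
    rw [pdy_const_mul _ (d (h.smooth_b.mul h.smooth_c)), pdy_mul (d h.smooth_b) (d h.smooth_c)]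
  fin_cases j
  · change pdy φ z = _
    simp [frameRow, frameV, Fin.sum_univ_four]
    ring
  · change pdy (fun w => pdx φ w - coefA c w * φ w) z = _
    rw [pdy_sub (d hx) (d (hA.mul h.smooth)), pdy_mul (d hA) (d h.smooth),
      ← pdx_pdy_comm h.smooth hD hz]
    simp [frameRow, frameV, Fin.sum_univ_four, coefL]
    ring
  · change pdy (fun w => pdy φ w - coefB b w * φ w) z = _
    rw [pdy_sub (d hy) (d (hB.mul h.smooth)), pdy_mul (d hB) (d h.smooth), h.eq_yy z hz]
    simp [frameRow, frameV, Fin.sum_univ_four, hQ]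
    ring
  · change pdy (fun w => pdx (pdy φ) w - coefA c w * pdy φ w - coefB b w * pdx φ w
      + (coefA c w * coefB b w - b w * c w / 2) * φ w) z = _
    rw [pdy_add (d ((hxy.sub (hA.mul hy)).sub (hB.mul hx)))
        (d (((hA.mul hB).sub hbc).mul h.smooth)),
      pdy_sub (d (hxy.sub (hA.mul hy))) (d (hB.mul hx)), pdy_sub (d hxy) (d (hA.mul hy)),
      pdy_mul (d hA) (d hy), pdy_mul (d hB) (d hx),
      pdy_mul (d ((hA.mul hB).sub hbc)) (d h.smooth), pdy_sub (d (hA.mul hB)) (d hbc),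
      pdy_mul (d hA) (d hB), hbc', h.pdy_pdx_pdy hz, ← pdx_pdy_comm h.smooth hD hz,
      h.eq_xx z hz, h.eq_yy z hz,
      pdx_eq_coefA (h.ne_c z hz), pdy_eq_coefB (h.ne_b z hz)]
    simp [frameRow, frameV, Fin.sum_univ_four, coefL, coefY, hQ]
    ring

end ScalarSystem

/-! ### From coordinate functions to the structure equations of F. -/

section Frame

variable {D : Set (ℝ × ℝ)} {b c p q : ℝ × ℝ → ℝ} {f : ℝ × ℝ → Fin 4 → ℝ} {z : ℝ × ℝ}

theorem contDiffOn_coord (hf : ContDiffOn ℝ ∞ f D) (i : Fin 4) :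
    ContDiffOn ℝ ∞ (fun w => f w i) D := contDiffOn_pi.1 hf i

theorem scalarSystem_coord (hf : IsCanonicalSystem D b c p q f) (hD : IsOpen D)
    (hbc : ∀ z ∈ D, b z * c z ≠ 0) (i : Fin 4) : ScalarSystem D b c p q (fun w => f w i) where
  isOpen := hD
  ne_b z hz := left_ne_zero_of_mul (hbc z hz)
  ne_c z hz := right_ne_zero_of_mul (hbc z hz)
  smooth_b := hf.smooth_b
  smooth_c := hf.smooth_c
  smooth_p := hf.smooth_p
  smooth_q := hf.smooth_q
  smooth := contDiffOn_coord hf.smooth_f i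
  eq_xx z hz := by
    have h1 : ∀ w ∈ D, pdx (fun v => f v i) w = pdx f w i := fun w hw =>
      (pdx_apply (differentiableAt_of_contDiffOn hf.smooth_f hD hw) i).symm
    rw [pdx_congr hD hz h1, ← pdx_apply
        (differentiableAt_of_contDiffOn (contDiffOn_pdx hf.smooth_f hD) hD hz), hf.eq_xx z hz,
      ← pdy_apply (differentiableAt_of_contDiffOn hf.smooth_f hD hz)]
    rfl
  eq_yy z hz := by
    have h1 : ∀ w ∈ D, pdy (fun v => f v i) w = pdy f w i := fun w hw =>
      (pdy_apply (differentiableAt_of_contDiffOn hf.smooth_f hD hw) i).symm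
    rw [pdy_congr hD hz h1, ← pdy_apply
        (differentiableAt_of_contDiffOn (contDiffOn_pdy hf.smooth_f hD) hD hz), hf.eq_yy z hz,
      ← pdx_apply (differentiableAt_of_contDiffOn hf.smooth_f hD hz)]
    rfl

theorem wilczynskiFrame_apply (hf : ContDiffOn ℝ ∞ f D) (hD : IsOpen D)
    (hb0 : ∀ z ∈ D, b z ≠ 0) (hc0 : ∀ z ∈ D, c z ≠ 0) (hz : z ∈ D) (i j : Fin 4) :
    wilczynskiFrame b c f z i j = frameRow b c (fun w => f w i) z j := by
  have hb := hb0 z hz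
  have hc := hc0 z hz
  have hy : ∀ w ∈ D, pdy f w i = pdy (fun v => f v i) w := fun w hw =>
    pdy_apply (differentiableAt_of_contDiffOn hf hD hw) i
  have hx := pdx_apply (differentiableAt_of_contDiffOn hf hD hz) i
  have hxy : pdx (pdy f) z i = pdx (pdy fun v => f v i) z := by
    rw [pdx_apply (differentiableAt_of_contDiffOn (contDiffOn_pdy hf hD) hD hz),
      pdx_congr hD hz hy]
  fin_cases j
  · simp [wilczynskiFrame, frameRow]
  · simp [wilczynskiFrame, frameRow, coefA, hx]
  · simp [wilczynskiFrame, frameRow, coefB, hy z hz]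
  · simp [wilczynskiFrame, frameRow, coefA, coefB, hx, hy z hz, hxy]
    -- The simplified goal reads: the coefficients of f_i agree, or f_i = 0. The coefficients do
    -- agree.
    left
    field_simp
    ring

theorem entrySmooth_wilczynskiFrame (hf : IsCanonicalSystem D b c p q f) (hD : IsOpen D)
    (hbc : ∀ z ∈ D, b z * c z ≠ 0) : EntrySmooth D (wilczynskiFrame b c f) := fun i j =>
  ((scalarSystem_coord hf hD hbc i).contDiffOn_frameRow j).congr fun _ hz =>
    wilczynskiFrame_apply hf.smooth_f hD (fun z hz => left_ne_zero_of_mul (hbc z hz))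
      (fun z hz => right_ne_zero_of_mul (hbc z hz)) hz i j

theorem mdx_wilczynskiFrame (hf : IsCanonicalSystem D b c p q f) (hD : IsOpen D)
    (hbc : ∀ z ∈ D, b z * c z ≠ 0) (hz : z ∈ D) :
    mdx (wilczynskiFrame b c f) z = wilczynskiFrame b c f z * frameU b c p q z := by
  have hF : ∀ w ∈ D, ∀ i j, wilczynskiFrame b c f w i j = frameRow b c (fun w => f w i) w j :=
    fun w hw i j => wilczynskiFrame_apply hf.smooth_f hD
      (fun z hz => left_ne_zero_of_mul (hbc z hz))
      (fun z hz => right_ne_zero_of_mul (hbc z hz)) hw i j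
  ext i j
  simp only [mdx, Matrix.of_apply, Matrix.mul_apply]
  rw [pdx_congr hD hz fun w hw => hF w hw i j, (scalarSystem_coord hf hD hbc i).pdx_frameRow hz j]
  exact Finset.sum_congr rfl fun m _ => by rw [hF z hz]

theorem mdy_wilczynskiFrame (hf : IsCanonicalSystem D b c p q f) (hD : IsOpen D)
    (hbc : ∀ z ∈ D, b z * c z ≠ 0) (hz : z ∈ D) :
    mdy (wilczynskiFrame b c f) z = wilczynskiFrame b c f z * frameV b c p q z := by
  have hF : ∀ w ∈ D, ∀ i j, wilczynskiFrame b c f w i j = frameRow b c (fun w => f w i) w j :=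
    fun w hw i j => wilczynskiFrame_apply hf.smooth_f hD
      (fun z hz => left_ne_zero_of_mul (hbc z hz))
      (fun z hz => right_ne_zero_of_mul (hbc z hz)) hw i j
  ext i j
  simp only [mdy, Matrix.of_apply, Matrix.mul_apply]
  rw [pdy_congr hD hz fun w hw => hF w hw i j, (scalarSystem_coord hf hD hbc i).pdy_frameRow hz j]
  exact Finset.sum_congr rfl fun m _ => by rw [hF z hz]

end Frame

/-! ### Integrability conditions and the harmonicity equations -/

section Integrability

variable {D : Set (ℝ × ℝ)} {b c p q : ℝ × ℝ → ℝ} {f : ℝ × ℝ → Fin 4 → ℝ} {z : ℝ × ℝ}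

theorem mdx_frameV (b c p q : ℝ × ℝ → ℝ) (z : ℝ × ℝ) : mdx (frameV b c p q) z =
    !![pdx (coefB b) z, pdx (coefL b c) z, pdx (invQ b c q) z, pdx (coefY b c p q) z;
       0, pdx (coefB b) z, pdx c z, pdx (invQ b c q) z;
       0, 0, -pdx (coefB b) z, pdx (coefL b c) z;
       0, 0, 0, -pdx (coefB b) z] := by
  ext i j
  fin_cases i <;> fin_cases j <;> first | rfl | exact pdx_const _ _ | exact pdx_neg _ _

theorem mdy_frameU (b c p q : ℝ × ℝ → ℝ) (z : ℝ × ℝ) : mdy (frameU b c p q) z =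
    !![pdy (coefA c) z, pdy (invP b c p) z, pdy (coefK b c) z, pdy (coefX b c p q) z;
       0, -pdy (coefA c) z, 0, pdy (coefK b c) z;
       0, pdy b z, pdy (coefA c) z, pdy (invP b c p) z;
       0, 0, 0, -pdy (coefA c) z] := by
  ext i j
  fin_cases i <;> fin_cases j <;> first | rfl | exact pdy_const _ _ | exact pdy_neg _ _

/-- Up to sign, `τ₁` is reflection in the anti-diagonal; 𝔭₁ consists of the matrices symmetric under
that reflection. -/
theorem τ₁_apply (X : Mat4) (i j : Fin 4) : τ₁ X i j = -X j.rev i.rev := by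
  simp only [τ₁, Matrix.neg_apply, Matrix.mul_apply, Fin.sum_univ_four, Matrix.transpose_apply]
  fin_cases i <;> fin_cases j <;> simp [J₁, Fin.rev]

theorem kPart_apply (X : Mat4) (i j : Fin 4) : kPart X i j = (X i j - X j.rev i.rev) / 2 := by
  simp only [kPart, Matrix.smul_apply, Matrix.add_apply, τ₁_apply, smul_eq_mul]
  ring

theorem pPart_apply (X : Mat4) (i j : Fin 4) : pPart X i j = (X i j + X j.rev i.rev) / 2 := by
  simp only [pPart, Matrix.smul_apply, Matrix.sub_apply, τ₁_apply, smul_eq_mul]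
  ring

/-- Off the diagonal, U is symmetric about the anti-diagonal, so only its diagonal survives in 𝔨₁.
-/
theorem kPart_frameU (b c p q : ℝ × ℝ → ℝ) (z : ℝ × ℝ) : kPart (frameU b c p q z) =
    !![coefA c z, 0, 0, 0; 0, -coefA c z, 0, 0; 0, 0, coefA c z, 0; 0, 0, 0, -coefA c z] := by
  ext i j
  fin_cases i <;> fin_cases j <;> simp [kPart_apply, frameU, Fin.rev] <;> ring

theorem pPart_frameV (b c p q : ℝ × ℝ → ℝ) (z : ℝ × ℝ) : pPart (frameV b c p q z) =
    !![0, coefL b c z, invQ b c q z, coefY b c p q z;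
       0, 0, c z, invQ b c q z;
       1, 0, 0, coefL b c z;
       0, 1, 0, 0] := by
  ext i j
  fin_cases i <;> fin_cases j <;> simp [pPart_apply, frameV, Fin.rev]

theorem pPart_mdx_frameV (b c p q : ℝ × ℝ → ℝ) (z : ℝ × ℝ) :
    pPart (mdx (frameV b c p q) z) =
      !![0, pdx (coefL b c) z, pdx (invQ b c q) z, pdx (coefY b c p q) z;
         0, 0, pdx c z, pdx (invQ b c q) z;
         0, 0, 0, pdx (coefL b c) z;
         0, 0, 0, 0] := by
  rw [mdx_frameV]
  ext i j
  fin_cases i <;> fin_cases j <;> simp [pPart_apply, Fin.rev]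

/-- The integrability conditions of the canonical system. -/
structure Integrability (D : Set (ℝ × ℝ)) (b c p q : ℝ × ℝ → ℝ) : Prop where
  pdy_P : ∀ z ∈ D, pdy (invP b c p) z = pdx (coefL b c) z + 2 * coefA c z * coefL b c z
  pdx_Q : ∀ z ∈ D, pdx (invQ b c q) z = pdy (coefK b c) z + 2 * coefB b z * coefK b c z
  eq_X : ∀ z ∈ D, coefX b c p q z = b z * invQ b c q z
  eq_Y : ∀ z ∈ D, coefY b c p q z = c z * invP b c p z
  euler_eq : ∀ z ∈ D, b z * pdy (invQ b c q) z + 2 * pdy b z * invQ b c q z =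
    c z * pdx (invP b c p) z + 2 * pdx c z * invP b c p z

/-- These are entries of the Maurer-Cartan equation, compared in pairs exchanged by the
anti-diagonal reflection. -/
theorem integrability (hf : IsCanonicalSystem D b c p q f) (hD : IsOpen D)
    (hbc : ∀ z ∈ D, b z * c z ≠ 0) (hF : ∀ z ∈ D, (wilczynskiFrame b c f z).det = 1) :
    Integrability D b c p q := by
  have hb0 : ∀ z ∈ D, b z ≠ 0 := fun z hz => left_ne_zero_of_mul (hbc z hz)
  have hc0 : ∀ z ∈ D, c z ≠ 0 := fun z hz => right_ne_zero_of_mul (hbc z hz)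
  have key : ∀ z ∈ D, _ := fun z hz => maurerCartan (entrySmooth_wilczynskiFrame hf hD hbc)
    (entrySmooth_frameU hf.smooth_b hf.smooth_c hf.smooth_p hf.smooth_q hD hb0 hc0)
    (entrySmooth_frameV hf.smooth_b hf.smooth_c hf.smooth_p hf.smooth_q hD hb0 hc0) hD hF
    (fun w hw => mdx_wilczynskiFrame hf hD hbc hw)
    (fun w hw => mdy_wilczynskiFrame hf hD hbc hw) hz
  have h01 : ∀ z ∈ D, _ := fun z hz => congrFun (congrFun (key z hz) 0) 1
  have h23 : ∀ z ∈ D, _ := fun z hz => congrFun (congrFun (key z hz) 2) 3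
  have h02 : ∀ z ∈ D, _ := fun z hz => congrFun (congrFun (key z hz) 0) 2
  have h13 : ∀ z ∈ D, _ := fun z hz => congrFun (congrFun (key z hz) 1) 3
  have h03 : ∀ z ∈ D, _ := fun z hz => congrFun (congrFun (key z hz) 0) 3
  clear key
  simp [-Prod.forall, mdx_frameV, mdy_frameU, frameU, frameV]
    at h01 h23 h02 h13 h03
  -- Entries (0,1) and (2,3) read L_x - P_y + 2AL ± (X - bQ) = 0: their difference gives X, their
  -- sum gives P_y. Entries (0,2) and (1,3) do the same for Y and Q_x.
  have hX : ∀ z ∈ D, coefX b c p q z = b z * invQ b c q z := fun z hz => by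
    linarith [h01 z hz, h23 z hz]
  have hY : ∀ z ∈ D, coefY b c p q z = c z * invP b c p z := fun z hz => by
    linarith [h02 z hz, h13 z hz]
  refine ⟨fun z hz => ?_, fun z hz => ?_, hX, hY, fun z hz => ?_⟩
  · linarith [h01 z hz, h23 z hz]
  · linarith [h02 z hz, h13 z hz]
  · have dP := differentiableAt_of_contDiffOn
      (contDiffOn_invP hf.smooth_b hf.smooth_c hf.smooth_p hD hb0 hc0) hD hz
    have dQ := differentiableAt_of_contDiffOn
      (contDiffOn_invQ hf.smooth_b hf.smooth_c hf.smooth_q hD hb0 hc0) hD hz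
    -- The corner entry contains Y_x - X_y; with X = bQ and Y = cP it identifies the two
    -- Euler-Lagrange expressions.
    have h := h03 z hz
    rw [pdx_congr hD hz hY, pdy_congr hD hz hX,
      pdx_mul (differentiableAt_of_contDiffOn hf.smooth_c hD hz) dP,
      pdy_mul (differentiableAt_of_contDiffOn hf.smooth_b hD hz) dQ, hX z hz, hY z hz] at h
    rw [pdx_eq_coefA (hc0 z hz), pdy_eq_coefB (hb0 z hz)] at h ⊢
    linarith

/-- Bracketing with the diagonal U_𝔨 multiplies each entry by a difference of diagonal entries: 0 or
±2A. Entry (1,2) is c_x - 2Ac = 0, entry (0,1) is L_x + 2AL = P_y, and the corner is (cP)_x + 2A·cP.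
-/
theorem harmonicDefect_frame (hint : Integrability D b c p q) (hD : IsOpen D)
    (hc : ContDiffOn ℝ ∞ c D) (hP : ContDiffOn ℝ ∞ (invP b c p) D)
    (hc0 : ∀ z ∈ D, c z ≠ 0) (hz : z ∈ D) :
    harmonicDefect (frameU b c p q) (frameV b c p q) z =
      !![0, pdy (invP b c p) z, pdx (invQ b c q) z,
           c z * pdx (invP b c p) z + 2 * pdx c z * invP b c p z;
         0, 0, 0, pdx (invQ b c q) z;
         0, 0, 0, pdy (invP b c p) z;
         0, 0, 0, 0] := by
  have hYx : pdx (coefY b c p q) z = c z * pdx (invP b c p) z + pdx c z * invP b c p z := by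
    rw [pdx_congr hD hz hint.eq_Y, pdx_mul (differentiableAt_of_contDiffOn hc hD hz)
      (differentiableAt_of_contDiffOn hP hD hz)]
  have hcx := pdx_eq_coefA (hc0 z hz)
  have hY := hint.eq_Y z hz
  have hPy := hint.pdy_P z hz
  rw [harmonicDefect, kPart_frameU, pPart_frameV, pPart_mdx_frameV, hPy, hYx, hcx, hY]
  ext i j
  fin_cases i <;> fin_cases j <;> simp <;> ring

theorem harmonicDefect_frame_eq_zero_iff (hint : Integrability D b c p q) (hD : IsOpen D)
    (hc : ContDiffOn ℝ ∞ c D) (hP : ContDiffOn ℝ ∞ (invP b c p) D)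
    (hc0 : ∀ z ∈ D, c z ≠ 0) (hz : z ∈ D) :
    harmonicDefect (frameU b c p q) (frameV b c p q) z = 0 ↔
      pdy (invP b c p) z = 0 ∧ pdx (invQ b c q) z = 0 ∧
        c z * pdx (invP b c p) z + 2 * pdx c z * invP b c p z = 0 := by
  rw [harmonicDefect_frame hint hD hc hP hc0 hz]
  refine ⟨fun h => ⟨?_, ?_, ?_⟩, fun ⟨h1, h2, h3⟩ => ?_⟩
  · simpa using congrFun (congrFun h 0) 1
  · simpa using congrFun (congrFun h 0) 2
  · simpa using congrFun (congrFun h 0) 3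
  · rw [h1, h2, h3]
    ext i j
    fin_cases i <;> fin_cases j <;> rfl

end Integrability

/-! ### Constancy along coordinate lines -/

section Lines

variable {E : Type*} [NormedAddCommGroup E] [NormedSpace ℝ E]

theorem hasDerivAt_pdx {h : ℝ × ℝ → E} {z : ℝ × ℝ} (hh : DifferentiableAt ℝ h z) :
    HasDerivAt (fun t => h (t, z.2)) (pdx h z) z.1 := by
  have h1 : HasDerivAt (fun t : ℝ => (t, z.2)) ((1, 0) : ℝ × ℝ) z.1 :=
    (hasDerivAt_id z.1).prodMk (hasDerivAt_const z.1 z.2)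
  exact HasFDerivAt.comp_hasDerivAt (f := fun t : ℝ => (t, z.2)) z.1 hh.hasFDerivAt h1

theorem hasDerivAt_pdy {h : ℝ × ℝ → E} {z : ℝ × ℝ} (hh : DifferentiableAt ℝ h z) :
    HasDerivAt (fun t => h (z.1, t)) (pdy h z) z.2 := by
  have h1 : HasDerivAt (fun t : ℝ => (z.1, t)) ((0, 1) : ℝ × ℝ) z.2 :=
    (hasDerivAt_const z.2 z.1).prodMk (hasDerivAt_id z.2)
  exact HasFDerivAt.comp_hasDerivAt (f := fun t : ℝ => (z.1, t)) z.2 hh.hasFDerivAt h1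

theorem eq_of_pdx_eq_zero {I J : Set ℝ} {h : ℝ × ℝ → E} (hI : IsOpen I) (hIc : IsPreconnected I)
    (hd : ∀ w ∈ I ×ˢ J, DifferentiableAt ℝ h w) (h0 : ∀ w ∈ I ×ˢ J, pdx h w = 0)
    {x x' y : ℝ} (hx : x ∈ I) (hx' : x' ∈ I) (hy : y ∈ J) : h (x, y) = h (x', y) := by
  have key : ∀ t ∈ I, HasDerivAt (fun t => h (t, y)) 0 t := fun t ht => by
    have := hasDerivAt_pdx (hd (t, y) ⟨ht, hy⟩)
    rwa [h0 (t, y) ⟨ht, hy⟩] at this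
  exact hI.is_const_of_deriv_eq_zero hIc
    (fun t ht => (key t ht).differentiableAt.differentiableWithinAt)
    (fun t ht => (key t ht).deriv) hx hx'

theorem eq_of_pdy_eq_zero {I J : Set ℝ} {h : ℝ × ℝ → E} (hJ : IsOpen J) (hJc : IsPreconnected J)
    (hd : ∀ w ∈ I ×ˢ J, DifferentiableAt ℝ h w) (h0 : ∀ w ∈ I ×ˢ J, pdy h w = 0)
    {x y y' : ℝ} (hx : x ∈ I) (hy : y ∈ J) (hy' : y' ∈ J) : h (x, y) = h (x, y') := by
  have key : ∀ t ∈ J, HasDerivAt (fun t => h (x, t)) 0 t := fun t ht => by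
    have := hasDerivAt_pdy (hd (x, t) ⟨hx, ht⟩)
    rwa [h0 (x, t) ⟨hx, ht⟩] at this
  exact hJ.is_const_of_deriv_eq_zero hJc
    (fun t ht => (key t ht).differentiableAt.differentiableWithinAt)
    (fun t ht => (key t ht).deriv) hy hy'

theorem exists_ball_prod_subset {D : Set (ℝ × ℝ)} (hD : IsOpen D) {z : ℝ × ℝ} (hz : z ∈ D) :
    ∃ ε > 0, Metric.ball z.1 ε ×ˢ Metric.ball z.2 ε ⊆ D := by
  obtain ⟨ε, hε, h⟩ := Metric.isOpen_iff.1 hD z hz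
  exact ⟨ε, hε, by rwa [ball_prod_same]⟩

end Lines

/-! ### Changes of coordinates on the line -/

section Line

theorem isOpen_image_of_deriv_ne_zero {I : Set ℝ} {X : ℝ → ℝ} (hI : IsOpen I)
    (hX : ContDiffOn ℝ ∞ X I) (h0 : ∀ x ∈ I, deriv X x ≠ 0) : IsOpen (X '' I) := by
  rw [isOpen_iff_mem_nhds]
  rintro _ ⟨x, hx, rfl⟩
  have hs : HasStrictDerivAt X (deriv X x) x :=
    (hX.contDiffAt (hI.mem_nhds hx)).hasStrictDerivAt (by simp)
  rw [← hs.map_nhds_eq (h0 x hx)]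
  exact Filter.image_mem_map (hI.mem_nhds hx)

/-- Injectivity supplies a global inverse on the image. Near each image point the local inverse
takes values in I, so the two coincide and smoothness is inherited. -/
theorem exists_smooth_inverse {I : Set ℝ} {X : ℝ → ℝ} (hI : IsOpen I)
    (hX : ContDiffOn ℝ ∞ X I) (hinj : Set.InjOn X I) (h0 : ∀ x ∈ I, deriv X x ≠ 0) :
    ∃ ξ : ℝ → ℝ, ContDiffOn ℝ ∞ ξ (X '' I) ∧ ∀ x ∈ I, ξ (X x) = x := by
  have hleft : ∀ x ∈ I, Function.invFunOn X I (X x) = x := fun x hx =>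
    hinj.leftInvOn_invFunOn hx
  refine ⟨Function.invFunOn X I, ?_, hleft⟩
  rintro _ ⟨x, hx, rfl⟩
  have hc := hX.contDiffAt (hI.mem_nhds hx)
  have hd : HasDerivAt X (deriv X x) x := (hc.differentiableAt (by simp)).hasDerivAt
  let e : ℝ ≃L[ℝ] ℝ := ContinuousLinearEquiv.unitsEquivAut ℝ (Units.mk0 _ (h0 x hx))
  have he : HasFDerivAt X (e : ℝ →L[ℝ] ℝ) x := by
    refine hd.hasFDerivAt.congr_fderiv ?_
    ext
    simp [e]
  have hs : ContDiffAt ℝ ∞ (hc.localInverse he (by simp)) (X x) := hc.to_localInverse he (by simp)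
  refine (hs.congr_of_eventuallyEq ?_).contDiffWithinAt
  have hstr : HasStrictFDerivAt X (e : ℝ →L[ℝ] ℝ) x := hc.hasStrictFDerivAt' he (by simp)
  have h1 : ∀ᶠ y in nhds (X x), X (hc.localInverse he (by simp) y) = y :=
    hstr.eventually_right_inverse
  have h2 : hc.localInverse he (by simp) (X x) = x := hstr.localInverse_apply_image
  have h3 : ∀ᶠ y in nhds (X x), hc.localInverse he (by simp) y ∈ I := by
    refine hs.continuousAt.eventually_mem ?_
    rw [h2]
    exact hI.mem_nhds hx
  filter_upwards [h1, h3] with y hy1 hy3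
  conv_lhs => rw [← hy1]
  exact hleft _ hy3

/-- The real cube root, in a form that is visibly smooth away from zero. -/
theorem exists_smooth_cubeRoot {I : Set ℝ} {ψ : ℝ → ℝ} (hψ : ContDiffOn ℝ ∞ ψ I)
    (h0 : ∀ x ∈ I, ψ x ≠ 0) : ∃ r : ℝ → ℝ, ContDiffOn ℝ ∞ r I ∧ ∀ x ∈ I, r x ^ 3 = ψ x := by
  -- The real power is applied only to ψ² > 0; the factor ψ carries the sign, and ψ³ · (ψ²)⁻¹ = ψ.
  refine ⟨fun x => ψ x * (ψ x ^ 2) ^ (-(1 / 3) : ℝ), hψ.mul ?_, fun x hx => ?_⟩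
  · exact (hψ.pow 2).rpow_const_of_ne fun x hx => pow_ne_zero 2 (h0 x hx)
  · have hpos : 0 < ψ x ^ 2 := by have := h0 x hx; positivity
    rw [mul_pow, ← Real.rpow_natCast ((ψ x ^ 2) ^ (-(1 / 3) : ℝ)), ← Real.rpow_mul hpos.le]
    norm_num [Real.rpow_neg_one]
    have := h0 x hx
    field_simp

/-- Integrate a smooth cube root of ψ from the centre of the interval. The derivative has no zero,
so injectivity follows from Rolle's theorem. -/
theorem exists_primitive_cubeRoot {x₀ ε : ℝ} {ψ : ℝ → ℝ} (hε : 0 < ε)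
    (hψ : ContDiffOn ℝ ∞ ψ (Metric.ball x₀ ε)) (h0 : ∀ x ∈ Metric.ball x₀ ε, ψ x ≠ 0) :
    ∃ X : ℝ → ℝ, ContDiffOn ℝ ∞ X (Metric.ball x₀ ε) ∧ Set.InjOn X (Metric.ball x₀ ε) ∧
      (∀ x ∈ Metric.ball x₀ ε, deriv X x ≠ 0) ∧
      ∀ x ∈ Metric.ball x₀ ε, deriv X x ^ 3 = ψ x := by
  obtain ⟨r, hr, hr3⟩ := exists_smooth_cubeRoot hψ h0
  have hord : (Metric.ball x₀ ε).OrdConnected := (convex_ball x₀ ε).ordConnected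
  have hX : ∀ x ∈ Metric.ball x₀ ε, HasDerivAt (fun x => ∫ t in x₀..x, r t) (r x) x := by
    intro x hx
    refine intervalIntegral.integral_hasDerivAt_right ?_ ?_
      (hr.continuousOn.continuousAt (Metric.isOpen_ball.mem_nhds hx))
    · exact (hr.continuousOn.mono
        (hord.uIcc_subset (Metric.mem_ball_self hε) hx)).intervalIntegrable
    · exact hr.continuousOn.stronglyMeasurableAtFilter Metric.isOpen_ball x hx
  have hrne : ∀ x ∈ Metric.ball x₀ ε, r x ≠ 0 := fun x hx h => by
    have := hr3 x hx
    rw [h] at this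
    exact h0 x hx (by rw [← this]; norm_num)
  refine ⟨fun x => ∫ t in x₀..x, r t, ?_, ?_, fun x hx => ?_, fun x hx => ?_⟩
  · rw [contDiffOn_infty_iff_deriv_of_isOpen Metric.isOpen_ball]
    exact ⟨fun x hx => (hX x hx).differentiableAt.differentiableWithinAt,
      hr.congr fun x hx => (hX x hx).deriv⟩
  · have key : ∀ a ∈ Metric.ball x₀ ε, ∀ b ∈ Metric.ball x₀ ε, a < b →
        (∫ t in x₀..a, r t) ≠ ∫ t in x₀..b, r t := by
      intro a ha b hb hab heq
      have hsub : Set.Icc a b ⊆ Metric.ball x₀ ε := hord.out ha hb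
      obtain ⟨m, hm, hm0⟩ := exists_hasDerivAt_eq_zero hab
        (fun x hx => (hX x (hsub hx)).continuousAt.continuousWithinAt) heq
        (fun x hx => hX x (hsub (Set.Ioo_subset_Icc_self hx)))
      exact hrne m (hsub (Set.Ioo_subset_Icc_self hm)) hm0
    intro a ha b hb hab
    rcases lt_trichotomy a b with h | h | h
    · exact absurd hab (key a ha b hb h)
    · exact h
    · exact absurd hab.symm (key b hb a ha h)
  · rw [(hX x hx).deriv]
    exact hrne x hx
  · rw [(hX x hx).deriv]
    exact hr3 x hx

theorem contDiffOn_deriv {I : Set ℝ} {X : ℝ → ℝ} (hI : IsOpen I) (hX : ContDiffOn ℝ ∞ X I) :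
    ContDiffOn ℝ ∞ (deriv X) I := ((contDiffOn_infty_iff_deriv_of_isOpen hI).1 hX).2

end Line

/-! ### Product changes of coordinates in the plane -/

section Chain

variable {E : Type*} [NormedAddCommGroup E] [NormedSpace ℝ E]

theorem hasFDerivAt_prodMap_comp {X Y : ℝ → ℝ} {h : ℝ × ℝ → E} {w : ℝ × ℝ}
    (hX : DifferentiableAt ℝ X w.1) (hY : DifferentiableAt ℝ Y w.2)
    (hh : DifferentiableAt ℝ h (X w.1, Y w.2)) :
    HasFDerivAt (fun w : ℝ × ℝ => h (X w.1, Y w.2))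
      ((fderiv ℝ h (X w.1, Y w.2)).comp
        (((fderiv ℝ X w.1).comp (ContinuousLinearMap.fst ℝ ℝ ℝ)).prod
          ((fderiv ℝ Y w.2).comp (ContinuousLinearMap.snd ℝ ℝ ℝ)))) w :=
  HasFDerivAt.comp (f := fun w : ℝ × ℝ => (X w.1, Y w.2)) w hh.hasFDerivAt
    ((hX.hasFDerivAt.comp w hasFDerivAt_fst).prodMk (hY.hasFDerivAt.comp w hasFDerivAt_snd))

theorem pdx_comp {X Y : ℝ → ℝ} {h : ℝ × ℝ → E} {w : ℝ × ℝ}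
    (hX : DifferentiableAt ℝ X w.1) (hY : DifferentiableAt ℝ Y w.2)
    (hh : DifferentiableAt ℝ h (X w.1, Y w.2)) :
    pdx (fun w : ℝ × ℝ => h (X w.1, Y w.2)) w = deriv X w.1 • pdx h (X w.1, Y w.2) := by
  rw [pdx, (hasFDerivAt_prodMap_comp hX hY hh).fderiv, pdx, ← map_smul]
  simp

theorem pdy_comp {X Y : ℝ → ℝ} {h : ℝ × ℝ → E} {w : ℝ × ℝ}
    (hX : DifferentiableAt ℝ X w.1) (hY : DifferentiableAt ℝ Y w.2)
    (hh : DifferentiableAt ℝ h (X w.1, Y w.2)) :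
    pdy (fun w : ℝ × ℝ => h (X w.1, Y w.2)) w = deriv Y w.2 • pdy h (X w.1, Y w.2) := by
  rw [pdy, (hasFDerivAt_prodMap_comp hX hY hh).fderiv, pdy, ← map_smul]
  simp

variable {I J : Set ℝ} {X Y : ℝ → ℝ} {g h : ℝ × ℝ → E} {w : ℝ × ℝ}

/-- First and second derivatives of a function in new coordinates `(X(x), Y(y))`. -/
theorem derivatives_change (hI : IsOpen I) (hJ : IsOpen J)
    (hX : ContDiffOn ℝ ∞ X I) (hX0 : ∀ x ∈ I, deriv X x ≠ 0)
    (hY : ContDiffOn ℝ ∞ Y J) (hY0 : ∀ y ∈ J, deriv Y y ≠ 0)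
    (hh : ContDiffOn ℝ ∞ h ((X '' I) ×ˢ (Y '' J)))
    (hgh : ∀ w ∈ I ×ˢ J, h (X w.1, Y w.2) = g w) (hw : w ∈ I ×ˢ J) :
    pdx g w = deriv X w.1 • pdx h (X w.1, Y w.2) ∧
    pdy g w = deriv Y w.2 • pdy h (X w.1, Y w.2) ∧
    pdx (pdx g) w = deriv X w.1 ^ 2 • pdx (pdx h) (X w.1, Y w.2) +
      deriv (deriv X) w.1 • pdx h (X w.1, Y w.2) ∧
    pdy (pdy g) w = deriv Y w.2 ^ 2 • pdy (pdy h) (X w.1, Y w.2) +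
      deriv (deriv Y) w.2 • pdy h (X w.1, Y w.2) := by
  have hN : IsOpen (I ×ˢ J) := hI.prod hJ
  have hN' : IsOpen ((X '' I) ×ˢ (Y '' J)) :=
    (isOpen_image_of_deriv_ne_zero hI hX hX0).prod (isOpen_image_of_deriv_ne_zero hJ hY hY0)
  have hm : ∀ w ∈ I ×ˢ J, (X w.1, Y w.2) ∈ (X '' I) ×ˢ (Y '' J) := fun w hw =>
    ⟨⟨w.1, hw.1, rfl⟩, ⟨w.2, hw.2, rfl⟩⟩
  have dX : ∀ w ∈ I ×ˢ J, DifferentiableAt ℝ X w.1 := fun w hw =>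
    (hX.contDiffAt (hI.mem_nhds hw.1)).differentiableAt (by simp)
  have dY : ∀ w ∈ I ×ˢ J, DifferentiableAt ℝ Y w.2 := fun w hw =>
    (hY.contDiffAt (hJ.mem_nhds hw.2)).differentiableAt (by simp)
  have dX' : DifferentiableAt ℝ (deriv X) w.1 :=
    ((contDiffOn_deriv hI hX).contDiffAt (hI.mem_nhds hw.1)).differentiableAt (by simp)
  have dY' : DifferentiableAt ℝ (deriv Y) w.2 :=
    ((contDiffOn_deriv hJ hY).contDiffAt (hJ.mem_nhds hw.2)).differentiableAt (by simp)
  have hx : ∀ w ∈ I ×ˢ J, pdx g w = deriv X w.1 • pdx h (X w.1, Y w.2) := fun w hw => by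
    rw [← pdx_comp (dX w hw) (dY w hw) (differentiableAt_of_contDiffOn hh hN' (hm w hw))]
    exact pdx_congr hN hw fun v hv => (hgh v hv).symm
  have hy : ∀ w ∈ I ×ˢ J, pdy g w = deriv Y w.2 • pdy h (X w.1, Y w.2) := fun w hw => by
    rw [← pdy_comp (dX w hw) (dY w hw) (differentiableAt_of_contDiffOn hh hN' (hm w hw))]
    exact pdy_congr hN hw fun v hv => (hgh v hv).symm
  have dhx := differentiableAt_of_contDiffOn (contDiffOn_pdx hh hN') hN' (hm w hw)
  have dhy := differentiableAt_of_contDiffOn (contDiffOn_pdy hh hN') hN' (hm w hw)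
  refine ⟨hx w hw, hy w hw, ?_, ?_⟩
  · have h1 : pdx (fun w : ℝ × ℝ => deriv X w.1) w = deriv (deriv X) w.1 := by
      have := pdx_comp (X := deriv X) (Y := id) (h := Prod.fst) dX' differentiableAt_id
        differentiableAt_fst
      simpa [pdx, fderiv_fst] using this
    rw [pdx_congr hN hw hx, pdx_smul (r := fun w : ℝ × ℝ => deriv X w.1)
      (h := fun w => pdx h (X w.1, Y w.2)) (dX'.comp w differentiableAt_fst)
      (hasFDerivAt_prodMap_comp (dX w hw) (dY w hw) dhx).differentiableAt, h1,
      pdx_comp (dX w hw) (dY w hw) dhx, smul_smul, sq]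
  · have h1 : pdy (fun w : ℝ × ℝ => deriv Y w.2) w = deriv (deriv Y) w.2 := by
      have := pdy_comp (X := id) (Y := deriv Y) (h := Prod.snd) differentiableAt_id dY'
        differentiableAt_snd
      simpa [pdy, fderiv_snd] using this
    rw [pdy_congr hN hw hy, pdy_smul (r := fun w : ℝ × ℝ => deriv Y w.2)
      (h := fun w => pdy h (X w.1, Y w.2)) (dY'.comp w differentiableAt_snd)
      (hasFDerivAt_prodMap_comp (dX w hw) (dY w hw) dhy).differentiableAt, h1,
      pdy_comp (dX w hw) (dY w hw) dhy, smul_smul, sq]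

theorem pdx_pdx_smul {D : Set (ℝ × ℝ)} {ρ : ℝ × ℝ → ℝ} (hD : IsOpen D)
    (hρ : ContDiffOn ℝ ∞ ρ D) (hh : ContDiffOn ℝ ∞ h D) (hw : w ∈ D) :
    pdx (pdx fun w => ρ w • h w) w =
      ρ w • pdx (pdx h) w + (2 * pdx ρ w) • pdx h w + pdx (pdx ρ) w • h w := by
  have d {g : ℝ × ℝ → E} (hg : ContDiffOn ℝ ∞ g D) := fun w (hw : w ∈ D) =>
    differentiableAt_of_contDiffOn hg hD hw
  have d' {g : ℝ × ℝ → ℝ} (hg : ContDiffOn ℝ ∞ g D) := fun w (hw : w ∈ D) =>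
    differentiableAt_of_contDiffOn hg hD hw
  have hρx := contDiffOn_pdx hρ hD
  have hhx := contDiffOn_pdx hh hD
  rw [pdx_congr hD hw fun v hv => pdx_smul (d' hρ v hv) (d hh v hv),
    pdx_add (g := fun v => ρ v • pdx h v) (h := fun v => pdx ρ v • h v)
      (d (hρ.smul hhx) w hw) (d (hρx.smul hh) w hw),
    pdx_smul (d' hρ w hw) (d hhx w hw), pdx_smul (d' hρx w hw) (d hh w hw)]
  module

theorem pdy_pdy_smul {D : Set (ℝ × ℝ)} {ρ : ℝ × ℝ → ℝ} (hD : IsOpen D)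
    (hρ : ContDiffOn ℝ ∞ ρ D) (hh : ContDiffOn ℝ ∞ h D) (hw : w ∈ D) :
    pdy (pdy fun w => ρ w • h w) w =
      ρ w • pdy (pdy h) w + (2 * pdy ρ w) • pdy h w + pdy (pdy ρ) w • h w := by
  have d {g : ℝ × ℝ → E} (hg : ContDiffOn ℝ ∞ g D) := fun w (hw : w ∈ D) =>
    differentiableAt_of_contDiffOn hg hD hw
  have d' {g : ℝ × ℝ → ℝ} (hg : ContDiffOn ℝ ∞ g D) := fun w (hw : w ∈ D) =>
    differentiableAt_of_contDiffOn hg hD hw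
  have hρy := contDiffOn_pdy hρ hD
  have hhy := contDiffOn_pdy hh hD
  rw [pdy_congr hD hw fun v hv => pdy_smul (d' hρ v hv) (d hh v hv),
    pdy_add (g := fun v => ρ v • pdy h v) (h := fun v => pdy ρ v • h v)
      (d (hρ.smul hhy) w hw) (d (hρy.smul hh) w hw),
    pdy_smul (d' hρ w hw) (d hhy w hw), pdy_smul (d' hρy w hw) (d hh w hw)]
  module

end Chain

/-! ### Coincidence surfaces -/

section Coincidence

variable {D : Set (ℝ × ℝ)} {b c p q : ℝ × ℝ → ℝ} {f : ℝ × ℝ → Fin 4 → ℝ}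

/-- In a frame, `f`, `f_x` and `f_y` are linearly independent. -/
theorem coeff_eq_zero_of_frame {z : ℝ × ℝ} (hF : (wilczynskiFrame b c f z).det = 1) {r s t : ℝ}
    (h : ∀ i, r * f z i + s * pdx f z i + t * pdy f z i = 0) : s = 0 ∧ t = 0 := by
  have hu : IsUnit (wilczynskiFrame b c f z).det := by rw [hF]; exact isUnit_one
  -- Since f_x = f₁ + Af and f_y = f₂ + Bf, passing to the frame changes only the coefficient of f.
  have hv : (wilczynskiFrame b c f z).mulVec
      ![r + s * (pdx c z / (2 * c z)) + t * (pdy b z / (2 * b z)), s, t, 0] = 0 := by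
    funext i
    have := h i
    simp [wilczynskiFrame, Matrix.mulVec, dotProduct, Fin.sum_univ_four]
    linarith
  have h0 := congrArg (fun v => (wilczynskiFrame b c f z)⁻¹.mulVec v) hv
  simp only [Matrix.mulVec_mulVec, Matrix.nonsing_inv_mul _ hu, Matrix.one_mulVec,
    Matrix.mulVec_zero] at h0
  exact ⟨congrFun h0 1, congrFun h0 2⟩

theorem pdy_sq_mul (hb : ContDiffOn ℝ ∞ b D) (hc : ContDiffOn ℝ ∞ c D) (hD : IsOpen D)
    {z : ℝ × ℝ} (hz : z ∈ D) : pdy (fun w => b w * b w * c w) z =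
      b z * b z * pdy c z + 2 * b z * pdy b z * c z := by
  have db := differentiableAt_of_contDiffOn hb hD hz
  rw [pdy_mul (db.fun_mul db) (differentiableAt_of_contDiffOn hc hD hz), pdy_mul db db]
  ring

theorem pdx_mul_sq (hb : ContDiffOn ℝ ∞ b D) (hc : ContDiffOn ℝ ∞ c D) (hD : IsOpen D)
    {z : ℝ × ℝ} (hz : z ∈ D) : pdx (fun w => b w * (c w * c w)) z =
      pdx b z * (c z * c z) + 2 * b z * c z * pdx c z := by
  have dc := differentiableAt_of_contDiffOn hc hD hz
  rw [pdx_mul (differentiableAt_of_contDiffOn hb hD hz) (dc.fun_mul dc), pdx_mul dc dc]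
  ring

/-- Expanding the new system in f, f_x, f_y and comparing coefficients gives bY' = X'² and cX' =
Y'². Hence b²c = X'³ depends on x alone and bc² = Y'³ on y alone. -/
theorem coefficients_of_isCoincidence (hf : IsCanonicalSystem D b c p q f) (hD : IsOpen D)
    (hF : ∀ z ∈ D, (wilczynskiFrame b c f z).det = 1)
    (hco : IsCoincidence D f) {z : ℝ × ℝ} (hz : z ∈ D) :
    pdy (fun w => b w * b w * c w) z = 0 ∧ pdx (fun w => b w * (c w * c w)) z = 0 := by
  obtain ⟨I, J, X, Y, ρ, p', q', f', hI, hJ, hzI, hzJ, hIJ, hX, -, hX0, hY, -, hY0, hρ, hρ0, hff,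
    hf'⟩ := hco z hz
  have hN : IsOpen (I ×ˢ J) := hI.prod hJ
  have key : ∀ w ∈ I ×ˢ J, b w * deriv Y w.2 = deriv X w.1 ^ 2 ∧
      c w * deriv X w.1 = deriv Y w.2 ^ 2 := by
    intro w hw
    have hwD := hIJ hw
    have hm : (X w.1, Y w.2) ∈ (X '' I) ×ˢ (Y '' J) :=
      ⟨⟨w.1, hw.1, rfl⟩, ⟨w.2, hw.2, rfl⟩⟩
    obtain ⟨hx, hy, hxx, hyy⟩ := derivatives_change hI hJ hX hX0 hY hY0 hf'.smooth_f hff hw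
    have dρ := differentiableAt_of_contDiffOn hρ hN hw
    have df := differentiableAt_of_contDiffOn hf.smooth_f hD hwD
    rw [pdx_smul dρ df] at hx
    rw [pdy_smul dρ df] at hy
    rw [pdx_pdx_smul hN hρ (hf.smooth_f.mono hIJ) hw, hf.eq_xx w hwD, hf'.eq_xx _ hm,
      hff w hw] at hxx
    rw [pdy_pdy_smul hN hρ (hf.smooth_f.mono hIJ) hw, hf.eq_yy w hwD, hf'.eq_yy _ hm,
      hff w hw] at hyy
    have hx1 := hX0 w.1 hw.1
    have hy1 := hY0 w.2 hw.2
    have hr := hρ0 w hw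
    generalize deriv X w.1 = X1, deriv Y w.2 = Y1, deriv (deriv X) w.1 = X2,
      deriv (deriv Y) w.2 = Y2, p' (X w.1, Y w.2) = p1, q' (X w.1, Y w.2) = q1 at *
    constructor
    -- The relation is X'Y' times the equation for f'_xx, with f'_x and f'_y eliminated by the
    -- first-order chain rule; only the coefficient t of f_y matters.
    · have := (coeff_eq_zero_of_frame (hF w hwD)
        (r := X1 * Y1 * (ρ w * p w + pdx (pdx ρ) w) - X1 ^ 3 * pdy ρ w - X1 ^ 3 * Y1 * p1 * ρ w
          - X2 * Y1 * pdx ρ w) (s := 2 * X1 * Y1 * pdx ρ w - X2 * Y1 * ρ w)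
        (t := X1 * ρ w * (b w * Y1 - X1 ^ 2)) fun i => by
          have e1 := congrFun hx i
          have e2 := congrFun hy i
          have e3 := congrFun hxx i
          simp only [Pi.add_apply, Pi.smul_apply, smul_eq_mul] at e1 e2 e3
          linear_combination X1 * Y1 * e3 - X1 ^ 3 * e2 - X2 * Y1 * e1).2
      exact sub_eq_zero.1 ((mul_eq_zero.1 this).resolve_left (mul_ne_zero hx1 hr))
    · have := (coeff_eq_zero_of_frame (hF w hwD)
        (r := X1 * Y1 * (ρ w * q w + pdy (pdy ρ) w) - Y1 ^ 3 * pdx ρ w - Y1 ^ 3 * X1 * q1 * ρ w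
          - Y2 * X1 * pdy ρ w) (t := 2 * X1 * Y1 * pdy ρ w - Y2 * X1 * ρ w)
        (s := Y1 * ρ w * (c w * X1 - Y1 ^ 2)) fun i => by
          have e1 := congrFun hx i
          have e2 := congrFun hy i
          have e3 := congrFun hyy i
          simp only [Pi.add_apply, Pi.smul_apply, smul_eq_mul] at e1 e2 e3
          linear_combination X1 * Y1 * e3 - Y1 ^ 3 * e1 - Y2 * X1 * e2).1
      exact sub_eq_zero.1 ((mul_eq_zero.1 this).resolve_left (mul_ne_zero hy1 hr))
  have key2 : ∀ w ∈ I ×ˢ J, b w * b w * c w = deriv X w.1 ^ 3 ∧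
      b w * (c w * c w) = deriv Y w.2 ^ 3 := by
    intro w hw
    obtain ⟨h1, h2⟩ := key w hw
    have hx1 := hX0 w.1 hw.1
    have hy1 := hY0 w.2 hw.2
    rw [← eq_div_iff hy1] at h1
    rw [← eq_div_iff hx1] at h2
    rw [h1, h2]
    constructor <;> field_simp
  have hzN : z ∈ I ×ˢ J := ⟨hzI, hzJ⟩
  have db := differentiableAt_of_contDiffOn hf.smooth_b hD hz
  have dc := differentiableAt_of_contDiffOn hf.smooth_c hD hz
  constructor
  · refine (hasDerivAt_pdy (h := fun w => b w * b w * c w) ((db.fun_mul db).mul dc)).unique ?_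
    refine (hasDerivAt_const z.2 (deriv X z.1 ^ 3)).congr_of_eventuallyEq ?_
    filter_upwards [hJ.mem_nhds hzJ] with t ht using (key2 (z.1, t) ⟨hzI, ht⟩).1
  · refine (hasDerivAt_pdx (h := fun w => b w * (c w * c w)) (db.fun_mul (dc.fun_mul dc))).unique ?_
    refine (hasDerivAt_const z.1 (deriv Y z.2 ^ 3)).congr_of_eventuallyEq ?_
    filter_upwards [hI.mem_nhds hzI] with t ht using (key2 (t, z.2) ⟨ht, hzJ⟩).2

/-- A coordinate change adapted to the coefficients gives a lift with `b = c = 1`. -/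
theorem exists_lift_of_coordinates (hf : IsCanonicalSystem D b c p q f) {I J : Set ℝ} {X Y : ℝ → ℝ}
    (hI : IsOpen I) (hJ : IsOpen J) (hIJ : I ×ˢ J ⊆ D)
    (hX : ContDiffOn ℝ ∞ X I) (hXi : Set.InjOn X I) (hX0 : ∀ x ∈ I, deriv X x ≠ 0)
    (hY : ContDiffOn ℝ ∞ Y J) (hYi : Set.InjOn Y J) (hY0 : ∀ y ∈ J, deriv Y y ≠ 0)
    (hb : ∀ w ∈ I ×ˢ J, b w * deriv Y w.2 = deriv X w.1 ^ 2)
    (hc : ∀ w ∈ I ×ˢ J, c w * deriv X w.1 = deriv Y w.2 ^ 2) :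
    ∃ (ρ p' q' : ℝ × ℝ → ℝ) (f' : ℝ × ℝ → Fin 4 → ℝ),
      ContDiffOn ℝ ∞ ρ (I ×ˢ J) ∧ (∀ w ∈ I ×ˢ J, ρ w ≠ 0) ∧
      (∀ w ∈ I ×ˢ J, f' (X w.1, Y w.2) = ρ w • f w) ∧
      IsCanonicalSystem ((X '' I) ×ˢ (Y '' J)) (fun _ => 1) (fun _ => 1) p' q' f' := by
  have hN : IsOpen (I ×ˢ J) := hI.prod hJ
  obtain ⟨ξ, hξ, hξX⟩ := exists_smooth_inverse hI hX hXi hX0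
  obtain ⟨ζ, hζ, hζY⟩ := exists_smooth_inverse hJ hY hYi hY0
  have sX1 : ContDiffOn ℝ ∞ (fun w : ℝ × ℝ => deriv X w.1) (I ×ˢ J) :=
    (contDiffOn_deriv hI hX).comp contDiffOn_fst fun w hw => hw.1
  have sY1 : ContDiffOn ℝ ∞ (fun w : ℝ × ℝ => deriv Y w.2) (I ×ˢ J) :=
    (contDiffOn_deriv hJ hY).comp contDiffOn_snd fun w hw => hw.2
  have hpos : ∀ w ∈ I ×ˢ J, 0 < (deriv X w.1 * deriv Y w.2) ^ 2 := fun w hw => by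
    have := hX0 w.1 hw.1
    have := hY0 w.2 hw.2
    positivity
  -- Here ρ = √|X'Y'|. Recording only ρ⁴ = (X'Y')² avoids absolute values and suffices for
  -- differentiation.
  obtain ⟨ρ, hρ, hρ0, hρ4⟩ : ∃ ρ : ℝ × ℝ → ℝ, ContDiffOn ℝ ∞ ρ (I ×ˢ J) ∧
      (∀ w ∈ I ×ˢ J, ρ w ≠ 0) ∧
      ∀ w ∈ I ×ˢ J, (ρ w * ρ w) * (ρ w * ρ w) =
        (deriv X w.1 * deriv Y w.2) * (deriv X w.1 * deriv Y w.2) := by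
    refine ⟨fun w => Real.sqrt (Real.sqrt ((deriv X w.1 * deriv Y w.2) ^ 2)), ?_, fun w hw => ?_,
      fun w hw => ?_⟩
    · exact (((sX1.mul sY1).pow 2).sqrt fun w hw => (hpos w hw).ne').sqrt fun w hw =>
        (Real.sqrt_pos.2 (hpos w hw)).ne'
    · exact (Real.sqrt_pos.2 (Real.sqrt_pos.2 (hpos w hw))).ne'
    · rw [Real.mul_self_sqrt (Real.sqrt_nonneg _), Real.mul_self_sqrt (hpos w hw).le, sq]
  have dX1 : ∀ w ∈ I ×ˢ J, DifferentiableAt ℝ (deriv X) w.1 := fun w hw =>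
    ((contDiffOn_deriv hI hX).contDiffAt (hI.mem_nhds hw.1)).differentiableAt (by simp)
  have dY1 : ∀ w ∈ I ×ˢ J, DifferentiableAt ℝ (deriv Y) w.2 := fun w hw =>
    ((contDiffOn_deriv hJ hY).contDiffAt (hJ.mem_nhds hw.2)).differentiableAt (by simp)
  -- This is the condition that the f'_x term cancels in the new equation for f'_xx.
  have hρx : ∀ w ∈ I ×ˢ J, 2 * deriv X w.1 * pdx ρ w = deriv (deriv X) w.1 * ρ w := by
    intro w hw
    have dρ := differentiableAt_of_contDiffOn hρ hN hw
    have dm := (differentiableAt_of_contDiffOn sX1 hN hw).fun_mul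
      (differentiableAt_of_contDiffOn sY1 hN hw)
    have h1 : pdx (fun w : ℝ × ℝ => deriv X w.1 * deriv Y w.2) w =
        deriv (deriv X) w.1 * deriv Y w.2 := by
      have := pdx_comp (X := deriv X) (Y := deriv Y) (h := fun w => w.1 * w.2) (dX1 w hw)
        (dY1 w hw) (differentiableAt_fst.mul differentiableAt_snd)
      rw [this, pdx_mul differentiableAt_fst differentiableAt_snd]
      simp [pdx, fderiv_fst, fderiv_snd]
    have h2 := pdx_congr hN hw hρ4
    rw [pdx_mul (dρ.fun_mul dρ) (dρ.fun_mul dρ), pdx_mul dρ dρ, pdx_mul dm dm, h1] at h2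
    have h3 := hρ4 w hw
    have hr : ρ w ^ 4 ≠ 0 := pow_ne_zero 4 (hρ0 w hw)
    refine mul_left_cancel₀ hr ?_
    linear_combination deriv X w.1 * ρ w / 2 * h2 - deriv (deriv X) w.1 * ρ w * h3
  have hρy : ∀ w ∈ I ×ˢ J, 2 * deriv Y w.2 * pdy ρ w = deriv (deriv Y) w.2 * ρ w := by
    intro w hw
    have dρ := differentiableAt_of_contDiffOn hρ hN hw
    have dm := (differentiableAt_of_contDiffOn sX1 hN hw).fun_mul
      (differentiableAt_of_contDiffOn sY1 hN hw)
    have h1 : pdy (fun w : ℝ × ℝ => deriv X w.1 * deriv Y w.2) w =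
        deriv (deriv Y) w.2 * deriv X w.1 := by
      have := pdy_comp (X := deriv X) (Y := deriv Y) (h := fun w => w.1 * w.2) (dX1 w hw)
        (dY1 w hw) (differentiableAt_fst.mul differentiableAt_snd)
      rw [this, pdy_mul differentiableAt_fst differentiableAt_snd]
      simp [pdy, fderiv_fst, fderiv_snd]
    have h2 := pdy_congr hN hw hρ4
    rw [pdy_mul (dρ.fun_mul dρ) (dρ.fun_mul dρ), pdy_mul dρ dρ, pdy_mul dm dm, h1] at h2
    have h3 := hρ4 w hw
    have hr : ρ w ^ 4 ≠ 0 := pow_ne_zero 4 (hρ0 w hw)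
    refine mul_left_cancel₀ hr ?_
    linear_combination deriv Y w.2 * ρ w / 2 * h2 - deriv (deriv Y) w.2 * ρ w * h3
  have sρx := contDiffOn_pdx hρ hN
  have sρy := contDiffOn_pdy hρ hN
  have sb := hf.smooth_b.mono hIJ
  have sc := hf.smooth_c.mono hIJ
  have sp := hf.smooth_p.mono hIJ
  have sq' := hf.smooth_q.mono hIJ
  have sf := hf.smooth_f.mono hIJ
  -- The coefficient of f' left over after f_x and f_y are expressed through f'_x, f'_y and f';
  -- similarly for Q'.
  let P' : ℝ × ℝ → ℝ := fun w =>
    (ρ w ^ 2 * p w + ρ w * pdx (pdx ρ) w - b w * ρ w * pdy ρ w - 2 * pdx ρ w ^ 2) /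
      (ρ w ^ 2 * deriv X w.1 ^ 2)
  let Q' : ℝ × ℝ → ℝ := fun w =>
    (ρ w ^ 2 * q w + ρ w * pdy (pdy ρ) w - c w * ρ w * pdx ρ w - 2 * pdy ρ w ^ 2) /
      (ρ w ^ 2 * deriv Y w.2 ^ 2)
  have sP' : ContDiffOn ℝ ∞ P' (I ×ˢ J) :=
    (((((hρ.pow 2).mul sp).add (hρ.mul (contDiffOn_pdx sρx hN))).sub
      ((sb.mul hρ).mul sρy)).sub (contDiffOn_const.mul (sρx.pow 2))).div
        ((hρ.pow 2).mul (sX1.pow 2)) fun w hw =>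
          mul_ne_zero (pow_ne_zero 2 (hρ0 w hw)) (pow_ne_zero 2 (hX0 w.1 hw.1))
  have sQ' : ContDiffOn ℝ ∞ Q' (I ×ˢ J) :=
    (((((hρ.pow 2).mul sq').add (hρ.mul (contDiffOn_pdy sρy hN))).sub
      ((sc.mul hρ).mul sρx)).sub (contDiffOn_const.mul (sρy.pow 2))).div
        ((hρ.pow 2).mul (sY1.pow 2)) fun w hw =>
          mul_ne_zero (pow_ne_zero 2 (hρ0 w hw)) (pow_ne_zero 2 (hY0 w.2 hw.2))
  let Ψ : ℝ × ℝ → ℝ × ℝ := fun u => (ξ u.1, ζ u.2)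
  have hΨ : ∀ w ∈ I ×ˢ J, Ψ (X w.1, Y w.2) = w := fun w hw => by
    simp only [Ψ, hξX w.1 hw.1, hζY w.2 hw.2]
  have sΨ : ContDiffOn ℝ ∞ Ψ ((X '' I) ×ˢ (Y '' J)) :=
    (hξ.comp contDiffOn_fst fun u hu => hu.1).prodMk (hζ.comp contDiffOn_snd fun u hu => hu.2)
  have mΨ : Set.MapsTo Ψ ((X '' I) ×ˢ (Y '' J)) (I ×ˢ J) := by
    rintro ⟨_, _⟩ ⟨⟨x, hx, rfl⟩, ⟨y, hy, rfl⟩⟩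
    have := hΨ (x, y) ⟨hx, hy⟩
    simp only at this
    rw [this]
    exact ⟨hx, hy⟩
  have hff : ∀ w ∈ I ×ˢ J, (fun u => ρ (Ψ u) • f (Ψ u)) (X w.1, Y w.2) = ρ w • f w := fun w hw => by
    simp only [hΨ w hw]
  have sf' : ContDiffOn ℝ ∞ (fun u => ρ (Ψ u) • f (Ψ u)) ((X '' I) ×ˢ (Y '' J)) :=
    (hρ.comp sΨ mΨ).smul (sf.comp sΨ mΨ)
  refine ⟨ρ, P' ∘ Ψ, Q' ∘ Ψ, fun u => ρ (Ψ u) • f (Ψ u), hρ, hρ0, hff,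
    contDiffOn_const, contDiffOn_const, sP'.comp sΨ mΨ, sQ'.comp sΨ mΨ, sf', ?_, ?_⟩
  · rintro ⟨_, _⟩ ⟨⟨x, hx, rfl⟩, ⟨y, hy, rfl⟩⟩
    have hw : (x, y) ∈ I ×ˢ J := ⟨hx, hy⟩
    have hΨw := hΨ _ hw
    have hbw := hb _ hw
    have hρw := hρx _ hw
    obtain ⟨ex, ey, exx, -⟩ := derivatives_change hI hJ hX hX0 hY hY0 sf' hff hw
    have dρ := differentiableAt_of_contDiffOn hρ hN hw
    have df := differentiableAt_of_contDiffOn sf hN hw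
    rw [pdx_smul dρ df] at ex
    rw [pdy_smul dρ df] at ey
    rw [pdx_pdx_smul hN hρ sf hw, hf.eq_xx _ (hIJ hw)] at exx
    have hP' : P' (x, y) * (ρ (x, y) ^ 2 * deriv X x ^ 2) = _ := div_mul_cancel₀ _
      (mul_ne_zero (pow_ne_zero 2 (hρ0 _ hw)) (pow_ne_zero 2 (hX0 x hx)))
    simp only [Function.comp_apply] at hΨw ex ey exx hbw hρw ⊢
    rw [hΨw]
    funext i
    have e1 := congrFun ex i
    have e2 := congrFun ey i
    have e3 := congrFun exx i
    simp only [Pi.add_apply, Pi.smul_apply, smul_eq_mul] at e1 e2 e3 ⊢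
    refine mul_left_cancel₀ (mul_ne_zero (hρ0 _ hw) (pow_ne_zero 2 (hX0 x hx))) ?_
    generalize pdx (fun u => ρ (Ψ u) • f (Ψ u)) (X x, Y y) i = u at *
    generalize pdy (fun u => ρ (Ψ u) • f (Ψ u)) (X x, Y y) i = v at *
    linear_combination -ρ (x, y) * e3 - f (x, y) i * hP' + u * hρw + 2 * pdx ρ (x, y) * e1 +
      b (x, y) * ρ (x, y) * e2 + ρ (x, y) * v * hbw
  · rintro ⟨_, _⟩ ⟨⟨x, hx, rfl⟩, ⟨y, hy, rfl⟩⟩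
    have hw : (x, y) ∈ I ×ˢ J := ⟨hx, hy⟩
    have hΨw := hΨ _ hw
    have hcw := hc _ hw
    have hρw := hρy _ hw
    obtain ⟨ex, ey, -, eyy⟩ := derivatives_change hI hJ hX hX0 hY hY0 sf' hff hw
    have dρ := differentiableAt_of_contDiffOn hρ hN hw
    have df := differentiableAt_of_contDiffOn sf hN hw
    rw [pdx_smul dρ df] at ex
    rw [pdy_smul dρ df] at ey
    rw [pdy_pdy_smul hN hρ sf hw, hf.eq_yy _ (hIJ hw)] at eyy
    have hQ' : Q' (x, y) * (ρ (x, y) ^ 2 * deriv Y y ^ 2) = _ := div_mul_cancel₀ _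
      (mul_ne_zero (pow_ne_zero 2 (hρ0 _ hw)) (pow_ne_zero 2 (hY0 y hy)))
    simp only [Function.comp_apply] at hΨw ex ey eyy hcw hρw ⊢
    rw [hΨw]
    funext i
    have e1 := congrFun ex i
    have e2 := congrFun ey i
    have e3 := congrFun eyy i
    simp only [Pi.add_apply, Pi.smul_apply, smul_eq_mul] at e1 e2 e3 ⊢
    refine mul_left_cancel₀ (mul_ne_zero (hρ0 _ hw) (pow_ne_zero 2 (hY0 y hy))) ?_
    generalize pdx (fun u => ρ (Ψ u) • f (Ψ u)) (X x, Y y) i = u at *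
    generalize pdy (fun u => ρ (Ψ u) • f (Ψ u)) (X x, Y y) i = v at *
    linear_combination -ρ (x, y) * e3 - f (x, y) i * hQ' + v * hρw + 2 * pdy ρ (x, y) * e2 +
      c (x, y) * ρ (x, y) * e1 + ρ (x, y) * u * hcw

/-- On a box b²c depends on x alone and bc² on y alone; X and Y are primitives of their cube roots.
-/
theorem isCoincidence_of_coefficients (hf : IsCanonicalSystem D b c p q f) (hD : IsOpen D)
    (hbc : ∀ z ∈ D, b z * c z ≠ 0)
    (hy : ∀ z ∈ D, pdy (fun w => b w * b w * c w) z = 0)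
    (hx : ∀ z ∈ D, pdx (fun w => b w * (c w * c w)) z = 0) : IsCoincidence D f := by
  intro z hz
  obtain ⟨ε, hε, hsub⟩ := exists_ball_prod_subset hD hz
  have hx0 : z.1 ∈ Metric.ball z.1 ε := Metric.mem_ball_self hε
  have hy0 : z.2 ∈ Metric.ball z.2 ε := Metric.mem_ball_self hε
  have s1 : ContDiffOn ℝ ∞ (fun w => b w * b w * c w) D :=
    (hf.smooth_b.mul hf.smooth_b).mul hf.smooth_c
  have s2 : ContDiffOn ℝ ∞ (fun w => b w * (c w * c w)) D :=
    hf.smooth_b.mul (hf.smooth_c.mul hf.smooth_c)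
  have hb0 : ∀ w ∈ D, b w ≠ 0 := fun z hz => left_ne_zero_of_mul (hbc z hz)
  have hc0 : ∀ w ∈ D, c w ≠ 0 := fun z hz => right_ne_zero_of_mul (hbc z hz)
  obtain ⟨X, hX, hXi, hX0, hX3⟩ := exists_primitive_cubeRoot hε
    (ψ := fun x => b (x, z.2) * b (x, z.2) * c (x, z.2))
    (s1.comp (contDiffOn_id.prodMk contDiffOn_const) fun x hx => hsub ⟨hx, hy0⟩)
    fun x hx => mul_ne_zero (mul_ne_zero (hb0 _ (hsub ⟨hx, hy0⟩)) (hb0 _ (hsub ⟨hx, hy0⟩)))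
      (hc0 _ (hsub ⟨hx, hy0⟩))
  obtain ⟨Y, hY, hYi, hY0, hY3⟩ := exists_primitive_cubeRoot hε
    (ψ := fun y => b (z.1, y) * (c (z.1, y) * c (z.1, y)))
    (s2.comp (contDiffOn_const.prodMk contDiffOn_id) fun y hy => hsub ⟨hx0, hy⟩)
    fun y hy => mul_ne_zero (hb0 _ (hsub ⟨hx0, hy⟩))
      (mul_ne_zero (hc0 _ (hsub ⟨hx0, hy⟩)) (hc0 _ (hsub ⟨hx0, hy⟩)))
  have key : ∀ w ∈ Metric.ball z.1 ε ×ˢ Metric.ball z.2 ε,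
      b w * b w * c w = deriv X w.1 ^ 3 ∧ b w * (c w * c w) = deriv Y w.2 ^ 3 := by
    rintro ⟨x, y⟩ ⟨hxw, hyw⟩
    constructor
    · rw [hX3 x hxw]
      exact eq_of_pdy_eq_zero (h := fun w => b w * b w * c w) Metric.isOpen_ball
        (convex_ball z.2 ε).isPreconnected
        (fun w hw => differentiableAt_of_contDiffOn s1 hD (hsub hw)) (fun w hw => hy w (hsub hw))
        hxw hyw hy0
    · rw [hY3 y hyw]
      exact eq_of_pdx_eq_zero (h := fun w => b w * (c w * c w)) Metric.isOpen_ball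
        (convex_ball z.1 ε).isPreconnected
        (fun w hw => differentiableAt_of_contDiffOn s2 hD (hsub hw)) (fun w hw => hx w (hsub hw))
        hxw hx0 hyw
  -- The product of the two cubes is (bc)³ = (X'Y')³ and real cubing is injective. Then X'·bY' =
  -- b·bc = X'³, which yields bY' = X'² after cancelling X'.
  have key2 : ∀ w ∈ Metric.ball z.1 ε ×ˢ Metric.ball z.2 ε,
      b w * c w = deriv X w.1 * deriv Y w.2 := by
    intro w hw
    obtain ⟨h1, h2⟩ := key w hw
    have h3 : (b w * c w) ^ 3 = (deriv X w.1 * deriv Y w.2) ^ 3 := by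
      rw [mul_pow (deriv X w.1), ← h1, ← h2]; ring
    exact (Odd.strictMono_pow (⟨1, rfl⟩ : Odd 3)).injective h3
  have hb : ∀ w ∈ Metric.ball z.1 ε ×ˢ Metric.ball z.2 ε,
      b w * deriv Y w.2 = deriv X w.1 ^ 2 := fun w hw =>
    mul_left_cancel₀ (hX0 w.1 hw.1) (by linear_combination (key w hw).1 - b w * key2 w hw)
  have hc : ∀ w ∈ Metric.ball z.1 ε ×ˢ Metric.ball z.2 ε,
      c w * deriv X w.1 = deriv Y w.2 ^ 2 := fun w hw =>
    mul_left_cancel₀ (hY0 w.2 hw.2) (by linear_combination (key w hw).2 - c w * key2 w hw)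
  obtain ⟨ρ, p', q', f', hρ, hρ0, hff, hf'⟩ := exists_lift_of_coordinates hf Metric.isOpen_ball
    Metric.isOpen_ball hsub hX hXi hX0 hY hYi hY0 hb hc
  exact ⟨_, _, X, Y, ρ, p', q', f', Metric.isOpen_ball, Metric.isOpen_ball, hx0, hy0, hsub,
    hX, hXi, hX0, hY, hYi, hY0, hρ, hρ0, hff, hf'⟩

end Coincidence

/-! ### Demoulin and coincidence surfaces -/

section Classification

variable {D : Set (ℝ × ℝ)} {b c p q u v : ℝ × ℝ → ℝ}

/-- A function whose zero set is locally constant on a connected open set vanishes identically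
as soon as it vanishes at one point. -/
theorem eq_zero_of_box (hD : IsOpen D) (hDc : IsConnected D) (hu : ContDiffOn ℝ ∞ u D)
    (hbox : ∀ z ∈ D, u z = 0 → ∀ ε > 0, Metric.ball z.1 ε ×ˢ Metric.ball z.2 ε ⊆ D →
      ∀ w ∈ Metric.ball z.1 ε ×ˢ Metric.ball z.2 ε, u w = 0)
    {z₀ : ℝ × ℝ} (hz₀ : z₀ ∈ D) (h0 : u z₀ = 0) : ∀ z ∈ D, u z = 0 := by
  by_contra! hne
  obtain ⟨z₁, hz₁, h1⟩ := hne
  have hU : IsOpen {z | z ∈ D ∧ u z = 0} := by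
    rw [isOpen_iff_mem_nhds]
    rintro z ⟨hz, hz0⟩
    obtain ⟨ε, hε, hsub⟩ := exists_ball_prod_subset hD hz
    have hmem : Metric.ball z.1 ε ×ˢ Metric.ball z.2 ε ∈ nhds z := by
      rw [ball_prod_same]
      exact Metric.ball_mem_nhds z hε
    filter_upwards [hmem] with w hw using ⟨hsub hw, hbox z hz hz0 ε hε hsub w hw⟩
  have hV : IsOpen {z | z ∈ D ∧ u z ≠ 0} := hu.continuousOn.isOpen_inter_preimage hD isOpen_ne
  obtain ⟨z, -, h, h'⟩ := hDc.isPreconnected _ _ hU hV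
    (fun z hz => (em (u z = 0)).imp (⟨hz, ·⟩) (⟨hz, ·⟩)) ⟨z₀, hz₀, hz₀, h0⟩ ⟨z₁, hz₁, hz₁, h1⟩
  exact h'.2 h.2

/-- In a box, u is constant along vertical segments, and v²u along horizontal ones because v times
the second equation is (v²u)_x = 0. A zero thus spreads to the whole box by one vertical and one
horizontal move. -/
theorem eq_zero_of_pdy_eq_zero (hD : IsOpen D) (hDc : IsConnected D) (hu : ContDiffOn ℝ ∞ u D)
    (hv : ContDiffOn ℝ ∞ v D) (hv0 : ∀ z ∈ D, v z ≠ 0) (hy : ∀ z ∈ D, pdy u z = 0)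
    (hx : ∀ z ∈ D, v z * pdx u z + 2 * pdx v z * u z = 0)
    {z₀ : ℝ × ℝ} (hz₀ : z₀ ∈ D) (h0 : u z₀ = 0) : ∀ z ∈ D, u z = 0 := by
  refine eq_zero_of_box hD hDc hu (fun z hz hz0 ε hε hsub w hw => ?_) hz₀ h0
  have s : ContDiffOn ℝ ∞ (fun w => v w * v w * u w) D := (hv.mul hv).mul hu
  have h1 : u (z.1, w.2) = u (z.1, z.2) := eq_of_pdy_eq_zero Metric.isOpen_ball
    (convex_ball z.2 ε).isPreconnected
    (fun w hw => differentiableAt_of_contDiffOn hu hD (hsub hw)) (fun w hw => hy w (hsub hw))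
    (Metric.mem_ball_self hε) hw.2 (Metric.mem_ball_self hε)
  have h2 := eq_of_pdx_eq_zero (h := fun w => v w * v w * u w) Metric.isOpen_ball
    (convex_ball z.1 ε).isPreconnected
    (fun w hw => differentiableAt_of_contDiffOn s hD (hsub hw)) (fun w hw => by
      have dv := differentiableAt_of_contDiffOn hv hD (hsub hw)
      rw [pdx_mul (dv.fun_mul dv) (differentiableAt_of_contDiffOn hu hD (hsub hw)), pdx_mul dv dv]
      linear_combination v w * hx w (hsub hw))
    hw.1 (Metric.mem_ball_self hε) hw.2
  simp only [h1, hz0, mul_zero] at h2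
  have hvw := hv0 w (hsub hw)
  exact (mul_eq_zero.1 h2).resolve_left (mul_ne_zero hvw hvw)

theorem eq_zero_of_pdx_eq_zero (hD : IsOpen D) (hDc : IsConnected D) (hu : ContDiffOn ℝ ∞ u D)
    (hv : ContDiffOn ℝ ∞ v D) (hv0 : ∀ z ∈ D, v z ≠ 0) (hx : ∀ z ∈ D, pdx u z = 0)
    (hy : ∀ z ∈ D, v z * pdy u z + 2 * pdy v z * u z = 0)
    {z₀ : ℝ × ℝ} (hz₀ : z₀ ∈ D) (h0 : u z₀ = 0) : ∀ z ∈ D, u z = 0 := by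
  refine eq_zero_of_box hD hDc hu (fun z hz hz0 ε hε hsub w hw => ?_) hz₀ h0
  have s : ContDiffOn ℝ ∞ (fun w => v w * v w * u w) D := (hv.mul hv).mul hu
  have h1 : u (w.1, z.2) = u (z.1, z.2) := eq_of_pdx_eq_zero Metric.isOpen_ball
    (convex_ball z.1 ε).isPreconnected
    (fun w hw => differentiableAt_of_contDiffOn hu hD (hsub hw)) (fun w hw => hx w (hsub hw))
    hw.1 (Metric.mem_ball_self hε) (Metric.mem_ball_self hε)
  have h2 := eq_of_pdy_eq_zero (h := fun w => v w * v w * u w) Metric.isOpen_ball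
    (convex_ball z.2 ε).isPreconnected
    (fun w hw => differentiableAt_of_contDiffOn s hD (hsub hw)) (fun w hw => by
      have dv := differentiableAt_of_contDiffOn hv hD (hsub hw)
      rw [pdy_mul (dv.fun_mul dv) (differentiableAt_of_contDiffOn hu hD (hsub hw)), pdy_mul dv dv]
      linear_combination v w * hy w (hsub hw))
    hw.1 hw.2 (Metric.mem_ball_self hε)
  simp only [h1, hz0, mul_zero] at h2
  have hvw := hv0 w (hsub hw)
  exact (mul_eq_zero.1 h2).resolve_left (mul_ne_zero hvw hvw)

/-- The mixed derivative of `b` when `b_x = -4 b A`. -/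
theorem pdx_coefB_of_pdx (hD : IsOpen D) (hb : ContDiffOn ℝ ∞ b D) (hc : ContDiffOn ℝ ∞ c D)
    (hb0 : ∀ z ∈ D, b z ≠ 0) (hc0 : ∀ z ∈ D, c z ≠ 0)
    (hbx : ∀ z ∈ D, pdx b z = b z * (-4 * coefA c z)) {z : ℝ × ℝ} (hz : z ∈ D) :
    pdx (coefB b) z = -2 * pdy (coefA c) z := by
  have db := differentiableAt_of_contDiffOn hb hD hz
  have dA := differentiableAt_of_contDiffOn (contDiffOn_coefA hc hD hc0) hD hz
  have dB := differentiableAt_of_contDiffOn (contDiffOn_coefB hb hD hb0) hD hz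
  have h := pdx_pdy_comm hb hD hz
  rw [pdx_congr hD hz fun w hw => pdy_eq_coefB (hb0 w hw), pdy_congr hD hz hbx,
    pdx_mul (db.const_mul 2) dB, pdx_const_mul 2 db, pdy_mul db (dA.const_mul (-4)),
    pdy_const_mul (-4) dA, hbx z hz, pdy_eq_coefB (hb0 z hz)] at h
  refine mul_left_cancel₀ (hb0 z hz) ?_
  linear_combination h / 2

/-- The mixed derivative of `c` when `c_y = -4 c B`. -/
theorem pdy_coefA_of_pdy (hD : IsOpen D) (hb : ContDiffOn ℝ ∞ b D) (hc : ContDiffOn ℝ ∞ c D)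
    (hb0 : ∀ z ∈ D, b z ≠ 0) (hc0 : ∀ z ∈ D, c z ≠ 0)
    (hcy : ∀ z ∈ D, pdy c z = c z * (-4 * coefB b z)) {z : ℝ × ℝ} (hz : z ∈ D) :
    pdy (coefA c) z = -2 * pdx (coefB b) z := by
  have dc := differentiableAt_of_contDiffOn hc hD hz
  have dA := differentiableAt_of_contDiffOn (contDiffOn_coefA hc hD hc0) hD hz
  have dB := differentiableAt_of_contDiffOn (contDiffOn_coefB hb hD hb0) hD hz
  have h := pdx_pdy_comm hc hD hz
  rw [pdy_congr hD hz fun w hw => pdx_eq_coefA (hc0 w hw), pdx_congr hD hz hcy,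
    pdy_mul (dc.const_mul 2) dA, pdy_const_mul 2 dc, pdx_mul dc (dB.const_mul (-4)),
    pdx_const_mul (-4) dB, hcy z hz, pdx_eq_coefA (hc0 z hz)] at h
  refine mul_left_cancel₀ (hc0 z hz) ?_
  linear_combination -h / 2

/-- Links the geometric form of the coincidence condition with the form used in the integrability
conditions. -/
theorem pdx_mul_sq_eq_zero_iff (hD : IsOpen D) (hb : ContDiffOn ℝ ∞ b D)
    (hc : ContDiffOn ℝ ∞ c D) (hc0 : ∀ z ∈ D, c z ≠ 0) {z : ℝ × ℝ} (hz : z ∈ D) :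
    pdx (fun w => b w * (c w * c w)) z = 0 ↔ pdx b z = b z * (-4 * coefA c z) := by
  have h : pdx (fun w => b w * (c w * c w)) z =
      (c z * c z) * (pdx b z - b z * (-4 * coefA c z)) := by
    rw [pdx_mul_sq hb hc hD hz, pdx_eq_coefA (hc0 z hz)]
    ring
  rw [h, mul_eq_zero, sub_eq_zero]
  simp [hc0 z hz]

theorem pdy_sq_mul_eq_zero_iff (hD : IsOpen D) (hb : ContDiffOn ℝ ∞ b D)
    (hc : ContDiffOn ℝ ∞ c D) (hb0 : ∀ z ∈ D, b z ≠ 0) {z : ℝ × ℝ} (hz : z ∈ D) :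
    pdy (fun w => b w * b w * c w) z = 0 ↔ pdy c z = c z * (-4 * coefB b z) := by
  have h : pdy (fun w => b w * b w * c w) z =
      (b z * b z) * (pdy c z - c z * (-4 * coefB b z)) := by
    rw [pdy_sq_mul hb hc hD hz, pdy_eq_coefB (hb0 z hz)]
    ring
  rw [h, mul_eq_zero, sub_eq_zero]
  simp [hb0 z hz]

theorem pdx_half_mul (hD : IsOpen D) (hb : ContDiffOn ℝ ∞ b D) (hc : ContDiffOn ℝ ∞ c D)
    {z : ℝ × ℝ} (hz : z ∈ D) :
    pdx (fun w => (1 / 2 : ℝ) * (b w * c w)) z = (b z * pdx c z + pdx b z * c z) / 2 := by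
  have db := differentiableAt_of_contDiffOn hb hD hz
  have dc := differentiableAt_of_contDiffOn hc hD hz
  rw [pdx_const_mul _ (db.fun_mul dc), pdx_mul db dc]
  ring

theorem pdy_half_mul (hD : IsOpen D) (hb : ContDiffOn ℝ ∞ b D) (hc : ContDiffOn ℝ ∞ c D)
    {z : ℝ × ℝ} (hz : z ∈ D) :
    pdy (fun w => (1 / 2 : ℝ) * (b w * c w)) z = (b z * pdy c z + pdy b z * c z) / 2 := by
  have db := differentiableAt_of_contDiffOn hb hD hz
  have dc := differentiableAt_of_contDiffOn hc hD hz
  rw [pdy_const_mul _ (db.fun_mul dc), pdy_mul db dc]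
  ring

/-- If `(log c)_xy = 0`, then `P_y = 0` if and only if `b_x = -4 b A`. -/
theorem pdy_invP_eq_zero_iff (hint : Integrability D b c p q) (hD : IsOpen D)
    (hb : ContDiffOn ℝ ∞ b D) (hc : ContDiffOn ℝ ∞ c D) (hc0 : ∀ z ∈ D, c z ≠ 0)
    (hA : ∀ z ∈ D, pdy (coefA c) z = 0) {z : ℝ × ℝ} (hz : z ∈ D) :
    pdy (invP b c p) z = 0 ↔ pdx b z = b z * (-4 * coefA c z) := by
  have hL : ∀ w ∈ D, coefL b c w = 1 / 2 * (b w * c w) := fun w hw => by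
    rw [coefL, hA w hw]; ring
  have h : pdy (invP b c p) z = c z / 2 * (pdx b z - b z * (-4 * coefA c z)) := by
    rw [hint.pdy_P z hz, pdx_congr hD hz hL, pdx_half_mul hD hb hc hz, hL z hz,
      pdx_eq_coefA (hc0 z hz)]
    ring
  rw [h, mul_eq_zero, sub_eq_zero]
  simp [hc0 z hz]

/-- If `(log b)_xy = 0`, then `Q_x = 0` if and only if `c_y = -4 c B`. -/
theorem pdx_invQ_eq_zero_iff (hint : Integrability D b c p q) (hD : IsOpen D)
    (hb : ContDiffOn ℝ ∞ b D) (hc : ContDiffOn ℝ ∞ c D) (hb0 : ∀ z ∈ D, b z ≠ 0)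
    (hB : ∀ z ∈ D, pdx (coefB b) z = 0) {z : ℝ × ℝ} (hz : z ∈ D) :
    pdx (invQ b c q) z = 0 ↔ pdy c z = c z * (-4 * coefB b z) := by
  have hK : ∀ w ∈ D, coefK b c w = 1 / 2 * (b w * c w) := fun w hw => by
    rw [coefK, hB w hw]; ring
  have h : pdx (invQ b c q) z = b z / 2 * (pdy c z - c z * (-4 * coefB b z)) := by
    rw [hint.pdx_Q z hz, pdy_congr hD hz hK, pdy_half_mul hD hb hc hz, hK z hz,
      pdy_eq_coefB (hb0 z hz)]
    ring
  rw [h, mul_eq_zero, sub_eq_zero]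
  simp [hb0 z hz]

/-- With u_x = -4Au and u_y = 0, equality of mixed derivatives gives 0 = -4A_y u. -/
theorem pdy_coefA_eq_zero (hD : IsOpen D) (hc : ContDiffOn ℝ ∞ c D) (hc0 : ∀ z ∈ D, c z ≠ 0)
    (hu : ContDiffOn ℝ ∞ u D) (hu0 : ∀ z ∈ D, u z ≠ 0) (hy : ∀ z ∈ D, pdy u z = 0)
    (hx : ∀ z ∈ D, c z * pdx u z + 2 * pdx c z * u z = 0) {z : ℝ × ℝ} (hz : z ∈ D) :
    pdy (coefA c) z = 0 := by
  have hux : ∀ w ∈ D, pdx u w = -4 * (coefA c w * u w) := fun w hw => by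
    refine mul_left_cancel₀ (hc0 w hw) ?_
    have := hx w hw
    rw [pdx_eq_coefA (hc0 w hw)] at this
    linear_combination this
  have dA := differentiableAt_of_contDiffOn (contDiffOn_coefA hc hD hc0) hD hz
  have du := differentiableAt_of_contDiffOn hu hD hz
  have h := pdx_pdy_comm hu hD hz
  rw [pdx_congr hD hz hy, pdx_const, pdy_congr hD hz hux, pdy_const_mul _ (dA.fun_mul du),
    pdy_mul dA du, hy z hz] at h
  refine (mul_eq_zero.1 ?_).resolve_right (hu0 z hz)
  linear_combination h / 4

theorem pdx_coefB_eq_zero (hD : IsOpen D) (hb : ContDiffOn ℝ ∞ b D) (hb0 : ∀ z ∈ D, b z ≠ 0)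
    (hu : ContDiffOn ℝ ∞ u D) (hu0 : ∀ z ∈ D, u z ≠ 0) (hx : ∀ z ∈ D, pdx u z = 0)
    (hy : ∀ z ∈ D, b z * pdy u z + 2 * pdy b z * u z = 0) {z : ℝ × ℝ} (hz : z ∈ D) :
    pdx (coefB b) z = 0 := by
  have huy : ∀ w ∈ D, pdy u w = -4 * (coefB b w * u w) := fun w hw => by
    refine mul_left_cancel₀ (hb0 w hw) ?_
    have := hy w hw
    rw [pdy_eq_coefB (hb0 w hw)] at this
    linear_combination this
  have dB := differentiableAt_of_contDiffOn (contDiffOn_coefB hb hD hb0) hD hz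
  have du := differentiableAt_of_contDiffOn hu hD hz
  have h := pdx_pdy_comm hu hD hz
  rw [pdy_congr hD hz hx, pdy_const, pdx_congr hD hz huy, pdx_const_mul _ (dB.fun_mul du),
    pdx_mul dB du, hx z hz] at h
  refine (mul_eq_zero.1 ?_).resolve_right (hu0 z hz)
  linear_combination -h / 4

/-- The surfaces with `P_y = Q_x = 0` and `c P_x + 2 c_x P = 0` are the Demoulin surfaces and the
projective minimal coincidence surfaces. -/
theorem demoulin_or_minimal_coincidence_iff {f : ℝ × ℝ → Fin 4 → ℝ} (hDo : IsOpen D)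
    (hDc : IsConnected D) (hf : IsCanonicalSystem D b c p q f) (hbc : ∀ z ∈ D, b z * c z ≠ 0)
    (hF : ∀ z ∈ D, (wilczynskiFrame b c f z).det = 1) :
    (IsDemoulin D b c p q ∨ (IsProjectiveMinimal D b c p q ∧ IsCoincidence D f)) ↔
      ∀ z ∈ D, pdy (invP b c p) z = 0 ∧ pdx (invQ b c q) z = 0 ∧
        c z * pdx (invP b c p) z + 2 * pdx c z * invP b c p z = 0 := by
  have hb0 : ∀ z ∈ D, b z ≠ 0 := fun z hz => left_ne_zero_of_mul (hbc z hz)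
  have hc0 : ∀ z ∈ D, c z ≠ 0 := fun z hz => right_ne_zero_of_mul (hbc z hz)
  have hint := integrability hf hDo hbc hF
  have hb := hf.smooth_b
  have hc := hf.smooth_c
  have sP := contDiffOn_invP hb hc hf.smooth_p hDo hb0 hc0
  have sQ := contDiffOn_invQ hb hc hf.smooth_q hDo hb0 hc0
  constructor
  · rintro (h | ⟨hmin, hco⟩) z hz
    · have hP : ∀ w ∈ D, invP b c p w = 0 := fun w hw => (h w hw).1
      have hQ : ∀ w ∈ D, invQ b c q w = 0 := fun w hw => (h w hw).2
      rw [pdy_congr hDo hz hP, pdx_congr hDo hz hP, pdx_congr hDo hz hQ, hP z hz]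
      simp [pdx_const, pdy_const]
    · have hbx : ∀ w ∈ D, pdx b w = b w * (-4 * coefA c w) := fun w hw =>
        (pdx_mul_sq_eq_zero_iff hDo hb hc hc0 hw).1
          (coefficients_of_isCoincidence hf hDo hF hco hw).2
      have hcy : ∀ w ∈ D, pdy c w = c w * (-4 * coefB b w) := fun w hw =>
        (pdy_sq_mul_eq_zero_iff hDo hb hc hb0 hw).1
          (coefficients_of_isCoincidence hf hDo hF hco hw).1
      have h1 : ∀ w ∈ D, _ := fun w hw => pdx_coefB_of_pdx hDo hb hc hb0 hc0 hbx hw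
      have h2 : ∀ w ∈ D, _ := fun w hw => pdy_coefA_of_pdy hDo hb hc hb0 hc0 hcy hw
      -- The relations B_x = -2A_y and A_y = -2B_x combine to A_y = 4A_y, so both derivatives
      -- vanish.
      exact ⟨(pdy_invP_eq_zero_iff hint hDo hb hc hc0
          (fun w hw => by linarith [h1 w hw, h2 w hw]) hz).2 (hbx z hz),
        (pdx_invQ_eq_zero_iff hint hDo hb hc hb0
          (fun w hw => by linarith [h1 w hw, h2 w hw]) hz).2 (hcy z hz), (hmin z hz).2⟩
  · intro h
    have hPy : ∀ z ∈ D, pdy (invP b c p) z = 0 := fun z hz => (h z hz).1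
    have hQx : ∀ z ∈ D, pdx (invQ b c q) z = 0 := fun z hz => (h z hz).2.1
    have hP : ∀ z ∈ D, _ := fun z hz => (h z hz).2.2
    have hQ : ∀ z ∈ D, b z * pdy (invQ b c q) z + 2 * pdy b z * invQ b c q z = 0 := fun z hz => by
      rw [hint.euler_eq z hz, hP z hz]
    -- One nowhere vanishing invariant suffices: it kills its own mixed logarithmic derivative, and
    -- the relation so obtained between b and c kills the other.
    by_cases hP0 : ∀ z ∈ D, invP b c p z ≠ 0
    · have hA : ∀ z ∈ D, pdy (coefA c) z = 0 := fun z hz =>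
        pdy_coefA_eq_zero hDo hc hc0 sP hP0 hPy hP hz
      have hbx : ∀ z ∈ D, pdx b z = b z * (-4 * coefA c z) := fun z hz =>
        (pdy_invP_eq_zero_iff hint hDo hb hc hc0 hA hz).1 (hPy z hz)
      have hB : ∀ z ∈ D, pdx (coefB b) z = 0 := fun z hz => by
        rw [pdx_coefB_of_pdx hDo hb hc hb0 hc0 hbx hz, hA z hz, mul_zero]
      exact Or.inr ⟨fun z hz => ⟨hQ z hz, hP z hz⟩, isCoincidence_of_coefficients hf hDo hbc
        (fun z hz => (pdy_sq_mul_eq_zero_iff hDo hb hc hb0 hz).2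
          ((pdx_invQ_eq_zero_iff hint hDo hb hc hb0 hB hz).1 (hQx z hz)))
        fun z hz => (pdx_mul_sq_eq_zero_iff hDo hb hc hc0 hz).2 (hbx z hz)⟩
    by_cases hQ0 : ∀ z ∈ D, invQ b c q z ≠ 0
    · have hB : ∀ z ∈ D, pdx (coefB b) z = 0 := fun z hz =>
        pdx_coefB_eq_zero hDo hb hb0 sQ hQ0 hQx hQ hz
      have hcy : ∀ z ∈ D, pdy c z = c z * (-4 * coefB b z) := fun z hz =>
        (pdx_invQ_eq_zero_iff hint hDo hb hc hb0 hB hz).1 (hQx z hz)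
      have hA : ∀ z ∈ D, pdy (coefA c) z = 0 := fun z hz => by
        rw [pdy_coefA_of_pdy hDo hb hc hb0 hc0 hcy hz, hB z hz, mul_zero]
      exact Or.inr ⟨fun z hz => ⟨hQ z hz, hP z hz⟩, isCoincidence_of_coefficients hf hDo hbc
        (fun z hz => (pdy_sq_mul_eq_zero_iff hDo hb hc hb0 hz).2 (hcy z hz))
        fun z hz => (pdx_mul_sq_eq_zero_iff hDo hb hc hc0 hz).2
          ((pdy_invP_eq_zero_iff hint hDo hb hc hc0 hA hz).1 (hPy z hz))⟩
    -- Now P and Q each have a zero, possibly at different points; each spreads over the connected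
    -- domain.
    push Not at hP0 hQ0
    obtain ⟨z₁, hz₁, h1⟩ := hP0
    obtain ⟨z₂, hz₂, h2⟩ := hQ0
    exact Or.inl fun z hz => ⟨eq_zero_of_pdy_eq_zero hDo hDc sP hc hc0 hPy hP hz₁ h1 z hz,
      eq_zero_of_pdx_eq_zero hDo hDc sQ hb hb0 hQx hQ hz₂ h2 z hz⟩

end Classification

end ProjSurf

end

/-! ### The three conditions compared through the harmonic defect. -/

theorem mainTheorem1 (D : Set (ℝ × ℝ)) (hDo : IsOpen D) (hDc : IsConnected D)
    (b c p q : ℝ × ℝ → ℝ) (f : ℝ × ℝ → Fin 4 → ℝ)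
    (hf : ProjSurf.IsCanonicalSystem D b c p q f)
    (hbc : ∀ z ∈ D, b z * c z ≠ 0)
    (hF : ∀ z ∈ D, (ProjSurf.wilczynskiFrame b c f z).det = 1) :
    List.TFAE [
      ProjSurf.IsDemoulin D b c p q ∨
        (ProjSurf.IsProjectiveMinimal D b c p q ∧ ProjSurf.IsCoincidence D f),
      ProjSurf.IsLorentzHarmonic D
        (ProjSurf.firstOrderGaussMap (ProjSurf.wilczynskiFrame b c f)),
      ∀ lam : ℝ, lam ≠ 0 →
        ProjSurf.IsFlat D (ProjSurf.Ulam (ProjSurf.wilczynskiFrame b c f) lam)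
          (ProjSurf.Vlam (ProjSurf.wilczynskiFrame b c f) lam)] := by
  have hb0 : ∀ z ∈ D, b z ≠ 0 := fun z hz => left_ne_zero_of_mul (hbc z hz)
  have hc0 : ∀ z ∈ D, c z ≠ 0 := fun z hz => right_ne_zero_of_mul (hbc z hz)
  have sF := ProjSurf.entrySmooth_wilczynskiFrame hf hDo hbc
  have sU := ProjSurf.entrySmooth_frameU hf.smooth_b hf.smooth_c hf.smooth_p hf.smooth_q hDo hb0 hc0
  have sV := ProjSurf.entrySmooth_frameV hf.smooth_b hf.smooth_c hf.smooth_p hf.smooth_q hDo hb0 hc0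
  have hx : ∀ w ∈ D, _ := fun w hw => ProjSurf.mdx_wilczynskiFrame hf hDo hbc hw
  have hy : ∀ w ∈ D, _ := fun w hw => ProjSurf.mdy_wilczynskiFrame hf hDo hbc hw
  have hdef := forall₂_congr fun z hz => ProjSurf.harmonicDefect_frame_eq_zero_iff
    (ProjSurf.integrability hf hDo hbc hF) hDo hf.smooth_c
    (ProjSurf.contDiffOn_invP hf.smooth_b hf.smooth_c hf.smooth_p hDo hb0 hc0) hc0 (z := z) hz
  have h1 := ProjSurf.demoulin_or_minimal_coincidence_iff hDo hDc hf hbc hF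
  have h2 := ProjSurf.isLorentzHarmonic_iff sF sU sV hDo hF hx hy
  have h3 := ProjSurf.isFlat_family_iff sF sU sV hDo hF hx hy
  tfae_have 1 ↔ 2 := by rw [h1, h2, hdef]
  tfae_have 2 ↔ 3 := by rw [h2, h3]
  tfae_finish
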